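/- Let $d\ge 3$, $r\ge 2$ and $n_1,\dots,n_d\ge r^2$; site indices are cyclic modulo $d$. For cores $Q=(Q_1,\dots,Q_d)$, $Q_k=(Q_k^{(\alpha)})_{\alpha\in[n_k]}$ with $Q_k^{(\alpha)}\in\mathbb C^{r\times r}$, let $T_Q(\alpha_1,\dots,\alpha_d)=\operatorname{tr}(Q_1^{(\alpha_1)}\cdots Q_d^{(\alpha_d)})$ and let $|\psi_Q\rangle=T_Q/\|T_Q\|$ be the matrix product state (MPS) of bond dimension $r$. For $S\subseteq[d]$ the marginal $\rho^S=\operatorname{tr}_{S^c}|\psi\rangle\langle\psi|$ has entries $\rho^S(\alpha,\beta)=\sum_{\gamma}\psi_{\alpha\gamma}\overline{\psi_{\beta\gamma}}$. Matrix rows and columns in $[r]\times[r]$ are listed with the first index slow; the unfoldings of a core $C$ are $C_{\langle 1\rangle}(\alpha,(a,b))=C^{(\alpha)}_{ab}$ and $C_{[1]}(\alpha,(b,a))=C^{(\alpha)}_{ab}$; $\dagger$ is the Moore–Penrose inverse. Probes. For each pair $(j,k)$ with $k=j+1$ fix $(h_\iota,v_\iota)$, $\iota=1,\dots,4$ (they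 may depend on the pair), with $h_\iota\in[d]\setminus\{j,k\}$ and unit vectors $v_\iota\in\mathbb C^{n_{h_\iota}}$, such that, with $w_\iota$ the vector of $\bigoplus_h\mathbb C^{n_h}$ equal to $v_\iota$ in the summand $h_\iota$ and $0$ elsewhere, $w_1,w_2$ are linearly independent, $w_3,w_4$ are linearly independent, and $\operatorname{span}(w_1,w_2)\ne\operatorname{span}(w_3,w_4)$. From the 3-body marginals define the $n_k\times n_j$ matrix $$M^{h,v}_{j,k}(\alpha_k,\alpha_j)=\sum_{\alpha_h,\alpha_h'}v_{\alpha_h}\overline{v_{\alpha'_h}}\;\rho^{\{h,j,k\}}\big((\alpha_k,\alpha_h,\alpha_j),(1,\alpha_h',1)\big).$$ Algorithm (input: the 3-body marginals). For each pair $(j,k)$, $k=j+1$: (1) choose $E_k\in\mathbb C^{n_k\times r^2}$ whose columns $(a,b)$, $a\in[r]$, form a basis of the eigenspace of the $b$-th nonzero eigenvalue of $M^{h_1,v_1}_{j,k}(M^{h_2,v_2}_{j,k})^\dagger$ (the nonzero eigenvalues being $r$ distinct ones of multiplicity $r$, in any order), and likewise $E_k'$ for $M^{h_3,v_3}_{j,k}(M^{h_4,v_4}_{j,k})^\dagger$;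 (2) with $F=E_k^\dagger E_k'$ and blocks $(F^{(b,c)})_{a,a'}=F_{(a,b),(a',c)}$, set $\hat K_1=I$ and $\hat K_\ell=F^{(1,1)}(F^{(\ell,1)})^{-1}$ for $\ell\ge2$; (3) define $\hat Q_k$ by $\hat Q_{k\langle1\rangle}=E_k\,\Pi(\hat K)^{-1}$, where $\Pi(\hat K)_{(a,b),(a',b')}=\delta_{bb'}(\hat K_b)_{aa'}$; (4) define $\tilde Q_j$ by $\tilde Q_{j[1]}=(\hat Q_{k\langle1\rangle}^\dagger M^{h_1,v_1}_{j,k})^{\top}$. Then for each $k\in[d]$ let $N_k$ be the top-left $r\times r$ block of $\tilde Q_{k[1]}^\dagger\hat Q_{k[1]}$ and output $\check Q_k^{(\alpha)}=\det(N_k^{-1})\,N_k^{\top}\tilde Q_k^{(\alpha)}$. Theorem. Let the cores $Q$ be random with a joint law that is absolutely continuous with respect to Lebesgue measure on $\prod_k\mathbb C^{n_k\times r\times r}$, and let the algorithm be given the 3-body marginals of $|\psi_Q\rangle$. Then with probability one: $T_Q\neq0$ (so that $|\psi_Q\rangle$ is a unit vector); eigenbases as in (1) exist; and for every choice of such eigenbases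 (i) all matrices inverted in (2) and (3) are invertible; (ii) after replacing the basis of the $b$-th eigenspace in $E_k$ by its image under $G_{k,b}\in\mathbb C^{r\times r}$, for Lebesgue-almost every $(G_{k,b})_{k\in[d],b\in[r]}$ the new $E_k$ are again admissible in (1) and all the resulting $N_k$ are invertible; (iii) whenever all $N_k$ are invertible, the output recovers the cores up to gauge and a global scalar: there are $c\in\mathbb C\setminus\{0\}$ and $L_1,\dots,L_d\in GL(r,\mathbb C)$ (indices cyclic) such that, after multiplying $\check Q_1$ by $c$, $\check Q_k^{(\alpha)}=L_k^{-1}Q_k^{(\alpha)}L_{k+1}$ for all $k$ and $\alpha$; and $|\psi_{\check Q}\rangle$ equals $|\psi_Q\rangle$ up to a global phase. -/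

import Mathlib

open MeasureTheory Matrix
open scoped Kronecker ComplexConjugate

noncomputable section

namespace BlostrMPS

/-! ### Moore-Penrose inverse -/

/-- The four Penrose equations: `B` is a Moore-Penrose inverse of `A`. -/
structure IsPinv {p q : Type*} [Fintype p] [Fintype q]
    (A : Matrix p q ℂ) (B : Matrix q p ℂ) : Prop where
  aba : A * B * A = A
  bab : B * A * B = B
  herm_ab : (A * B)ᴴ = A * B
  herm_ba : (B * A)ᴴ = B * A

theorem IsPinv.unique {p q : Type*} [Fintype p] [Fintype q]
    {A : Matrix p q ℂ} {B C : Matrix q p ℂ} (hB : IsPinv A B) (hC : IsPinv A C) : B = C := by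
  have h1 : A * B = A * C := by
    have e : (A * C) * (A * B) = A * B := by
      rw [← Matrix.mul_assoc, hC.aba]
    have e2 := congrArg conjTranspose e
    rw [conjTranspose_mul, hB.herm_ab, hC.herm_ab, ← Matrix.mul_assoc, hB.aba] at e2
    exact e2.symm
  have h2 : B * A = C * A := by
    have e : (B * A) * (C * A) = B * A := by
      rw [Matrix.mul_assoc, ← Matrix.mul_assoc A, hC.aba]
    have e2 := congrArg conjTranspose e
    rw [conjTranspose_mul, hB.herm_ba, hC.herm_ba, Matrix.mul_assoc, ← Matrix.mul_assoc A,
      hB.aba] at e2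
    exact e2.symm
  rw [← hB.bab, Matrix.mul_assoc, h1, ← Matrix.mul_assoc, h2, hC.bab]

open scoped ComplexOrder in
theorem exists_isPinv {p q : Type*} [Fintype p] [Fintype q] [DecidableEq q]
    (A : Matrix p q ℂ) : ∃ B, IsPinv A B := by
  have hH : (Aᴴ * A).IsHermitian := isHermitian_conjTranspose_mul_self A
  obtain ⟨G, hG, hcomm, hHGH, hGHG⟩ : ∃ G : Matrix q q ℂ, Gᴴ = G ∧
      (Aᴴ * A) * G = G * (Aᴴ * A) ∧ (Aᴴ * A) * G * (Aᴴ * A) = Aᴴ * A ∧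
      G * (Aᴴ * A) * G = G := by
    set U : Matrix q q ℂ := (hH.eigenvectorUnitary : Matrix q q ℂ) with hU
    have hUU : Uᴴ * U = 1 := by
      rw [hU, ← star_eq_conjTranspose]; exact Unitary.coe_star_mul_self _
    set D : Matrix q q ℂ := diagonal (fun i => (hH.eigenvalues i : ℂ)) with hD
    set D' : Matrix q q ℂ := diagonal (fun i => ((hH.eigenvalues i : ℂ))⁻¹) with hD'
    have hspec : Aᴴ * A = U * D * Uᴴ := by
      have := hH.spectral_theorem
      rw [Unitary.conjStarAlgAut_apply] at this
      exact this
    have key : ∀ X Y : Matrix q q ℂ, (U * X * Uᴴ) * (U * Y * Uᴴ) = U * (X * Y) * Uᴴ := by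
      intro X Y
      calc (U * X * Uᴴ) * (U * Y * Uᴴ) = U * X * (Uᴴ * U) * Y * Uᴴ := by
            simp only [Matrix.mul_assoc]
        _ = U * (X * Y) * Uᴴ := by rw [hUU]; simp only [Matrix.mul_assoc, Matrix.mul_one]
    refine ⟨U * D' * Uᴴ, ?_, ?_, ?_, ?_⟩
    · have : D'ᴴ = D' := by
        rw [hD', diagonal_conjTranspose]
        congr 1
        funext i
        simp
      rw [conjTranspose_mul, conjTranspose_mul, conjTranspose_conjTranspose, this,
        Matrix.mul_assoc]
    · rw [hspec, key, key]
      congr 2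
      simp [hD, hD', diagonal_mul_diagonal, mul_comm]
    · rw [hspec, key, key]
      congr 2
      simp [hD, hD', diagonal_mul_diagonal]
    · rw [hspec, key, key]
      congr 2
      simp only [hD, hD', diagonal_mul_diagonal]
      congr 1
      funext i
      by_cases h : (hH.eigenvalues i : ℂ) = 0 <;> simp [h]
  have hA : A * G * (Aᴴ * A) = A := by
    have : (A * G * (Aᴴ * A) - A)ᴴ * (A * G * (Aᴴ * A) - A) = 0 := by
      have e1 : (A * G * (Aᴴ * A) - A)ᴴ = ((Aᴴ * A) * G - 1) * Aᴴ := by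
        rw [conjTranspose_sub, conjTranspose_mul (A * G), hH.eq, conjTranspose_mul A, hG,
          Matrix.sub_mul, Matrix.one_mul, Matrix.mul_assoc (Aᴴ * A)]
      have e2 : Aᴴ * (A * G * (Aᴴ * A) - A) = 0 := by
        rw [Matrix.mul_sub, ← Matrix.mul_assoc, ← Matrix.mul_assoc Aᴴ A G, hHGH, sub_self]
      rw [e1, Matrix.mul_assoc, e2, Matrix.mul_zero]
    exact sub_eq_zero.mp (conjTranspose_mul_self_eq_zero.mp this)
  refine ⟨G * Aᴴ, ?_, ?_, ?_, ?_⟩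
  · rw [← Matrix.mul_assoc, Matrix.mul_assoc (A * G), hA]
  · calc G * Aᴴ * A * (G * Aᴴ) = G * (Aᴴ * A) * G * Aᴴ := by simp only [Matrix.mul_assoc]
      _ = G * Aᴴ := by rw [hGHG]
  · simp only [conjTranspose_mul, conjTranspose_conjTranspose, hG, Matrix.mul_assoc]
  · rw [Matrix.mul_assoc, conjTranspose_mul, hG, hH.eq, hcomm]

/-- The Moore-Penrose inverse (it exists and is unique). -/
def pinv {p q : Type*} [Fintype p] [Fintype q] [DecidableEq q] (A : Matrix p q ℂ) :
    Matrix q p ℂ := (exists_isPinv A).choose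

/-! ### Cores, matrix product states, gauge, marginals

Sites are `Fin d`, so that `k + 1` and `k - 1` are cyclic. -/

section Model

variable {d : ℕ} (n : Fin d → ℕ) (r : ℕ)

/-- A family of cores; `Q k α` is the `r × r` slice of the `k`-th core at index `α`. -/
abbrev Cores : Type := (k : Fin d) → Fin (n k) → Fin r → Fin r → ℂ

/-- Multi-indices of the tensor. -/
abbrev Idx : Type := (k : Fin d) → Fin (n k)

/-- Access to the marginals on subsystems of at most three sites, and to nothing else. -/
abbrev ThreeBody : Type :=
  (S : Finset (Fin d)) → S.card ≤ 3 →
    Matrix ((k : S) → Fin (n k)) ((k : S) → Fin (n k)) ℂ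

variable {n r}

/-- The slice as a matrix. -/
def slice (Q : Cores n r) (k : Fin d) (α : Fin (n k)) : Matrix (Fin r) (Fin r) ℂ :=
  Matrix.of (Q k α)

/-- The tensor ring: trace of the product of the slices in the order of the sites. -/
def ringTensor (Q : Cores n r) (α : Idx n) : ℂ :=
  ((List.ofFn fun k => slice Q k (α k)).prod).trace

/-- The matrix product state of the cores: the tensor ring, normalized to a unit vector. -/
def mpsState (Q : Cores n r) (α : Idx n) : ℂ :=
  ((Real.sqrt (∑ β, ‖ringTensor Q β‖ ^ 2) : ℝ) : ℂ)⁻¹ * ringTensor Q α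

/-- The multi-index equal to `a` on `S` and to `c` off `S`. -/
def glue (S : Finset (Fin d)) (a : (k : S) → Fin (n k))
    (c : (k : {k : Fin d // k ∉ S}) → Fin (n k)) : Idx n :=
  fun k => if h : k ∈ S then a ⟨k, h⟩ else c ⟨k, h⟩

/-- The marginal of `ψ` on `S`: partial trace of `|ψ⟩⟨ψ|` over the complement of `S`. -/
def marginal (ψ : Idx n → ℂ) (S : Finset (Fin d)) :
    Matrix ((k : S) → Fin (n k)) ((k : S) → Fin (n k)) ℂ :=
  Matrix.of fun a b => ∑ c : (k : {k : Fin d // k ∉ S}) → Fin (n k),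
    ψ (glue S a c) * conj (ψ (glue S b c))

/-- The marginals of `ψ` on at most three sites. -/
def threeBody (ψ : Idx n → ℂ) : ThreeBody n := fun S _ => marginal ψ S

/-- Gauge equivalence: `Q' k α = L k⁻¹ * Q k α * L (k+1)` with invertible `L k`. -/
def GaugeEquiv [NeZero d] (Q Q' : Cores n r) : Prop :=
  ∃ L : Fin d → GL (Fin r) ℂ, ∀ (k : Fin d) (α : Fin (n k)),
    slice Q' k α = ((L k)⁻¹ : GL (Fin r) ℂ).val * slice Q k α * (L (k + 1)).val

/-- Multiply the core of the first site by `c`. -/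
def scaleFirst [NeZero d] (c : ℂ) (Q : Cores n r) : Cores n r :=
  fun k α a b => (if k = 0 then c else 1) * Q k α a b

end Model

/-! ### One pair of neighbouring sites -/

section Pair

variable {r m : ℕ}

/-- `E` is a full eigenbasis of `A` for its nonzero spectrum, which consists of `r` distinct
eigenvalues of multiplicity `r`. The column `(a, b)` (in position `a * r + b`) is the `a`-th
basis vector of the eigenspace of the `b`-th eigenvalue; order and bases are free. -/
def IsEigenbasis (A : Matrix (Fin m) (Fin m) ℂ) (E : Matrix (Fin m) (Fin r × Fin r) ℂ) : Prop :=
  ∃ lam : Fin r → ℂ, Function.Injective lam ∧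
    (∀ z : ℂ, z ∈ Set.range lam ↔ z ≠ 0 ∧ Module.End.HasEigenvalue (Matrix.toLin' A) z) ∧
    ∀ b : Fin r,
      LinearIndependent ℂ (fun a : Fin r => fun i : Fin m => E i (a, b)) ∧
      Submodule.span ℂ (Set.range fun a : Fin r => fun i : Fin m => E i (a, b)) =
        Module.End.eigenspace (Matrix.toLin' A) (lam b)

/-- The block `F^{(j,k)}` of `F = E† E'`. -/
def blockF (E E' : Matrix (Fin m) (Fin r × Fin r) ℂ) (j k : Fin r) : Matrix (Fin r) (Fin r) ℂ :=
  Matrix.of fun a c => (pinv E * E') (a, j) (c, k)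

/-- `K̂_1 = I` and `K̂_ℓ = F^{(1,1)} (F^{(ℓ,1)})⁻¹`. -/
def hatK [NeZero r] (E E' : Matrix (Fin m) (Fin r × Fin r) ℂ) (l : Fin r) :
    Matrix (Fin r) (Fin r) ℂ :=
  if l = 0 then 1 else blockF E E' 0 0 * (blockF E E' l 0)⁻¹

/-- The unfolding `⟨1⟩` of the recovered core, `E (Π(K̂))⁻¹`. Mathlib's `blockDiagonal` has the
block number as the second (fast) index, so `blockDiagonal K̂` is the permuted matrix `Π(K̂)`. -/
def hatUnfold [NeZero r] (E E' : Matrix (Fin m) (Fin r × Fin r) ℂ) :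
    Matrix (Fin m) (Fin r × Fin r) ℂ :=
  E * (Matrix.blockDiagonal (hatK E E'))⁻¹

/-- Change of basis by `G b` within the `b`-th eigenspace. -/
def rotate (G : Fin r → Fin r → Fin r → ℂ) (E : Matrix (Fin m) (Fin r × Fin r) ℂ) :
    Matrix (Fin m) (Fin r × Fin r) ℂ :=
  E * Matrix.blockDiagonal fun b => Matrix.of (G b)

end Pair

/-! ### The algorithm -/

section Algorithm

variable {d : ℕ} [NeZero d] (n : Fin d → ℕ)

/-- For the pair `(k - 1, k)`, four sites and four vectors on these sites. -/
structure Probes where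
  site : Fin d → Fin 4 → Fin d
  vec : (k : Fin d) → (i : Fin 4) → Fin (n (site k i)) → ℂ

variable {n}

/-- The probe `(h, v)` as a vector of the direct sum of all the local spaces. -/
def Probes.embed (p : Probes n) (k : Fin d) (i : Fin 4) : (l : Fin d) → Fin (n l) → ℂ :=
  Pi.single (p.site k i) (p.vec k i)

/-- Unit probe vectors on sites other than `k - 1` and `k`; the first two probes differ, the last
two probes differ, and the two pairs differ, all of it up to linear combination. For standard
basis vectors on one site this says `α ≠ β`, `α' ≠ β'`, `{α, β} ≠ {α', β'}`. -/
structure Probes.Admissible (p : Probes n) : Prop where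
  ne_left : ∀ k i, p.site k i ≠ k - 1
  ne_right : ∀ k i, p.site k i ≠ k
  unit : ∀ k i, ∑ a, ‖p.vec k i a‖ ^ 2 = 1
  first : ∀ k, LinearIndependent ℂ ![p.embed k 0, p.embed k 1]
  second : ∀ k, LinearIndependent ℂ ![p.embed k 2, p.embed k 3]
  pairs : ∀ k, Submodule.span ℂ {p.embed k 0, p.embed k 1} ≠
    Submodule.span ℂ {p.embed k 2, p.embed k 3}

variable [∀ k, NeZero (n k)]

/-- The multi-index with `x` at `k`, `y` at `j`, `s` at `h` and the first index elsewhere. -/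
def idx3 (j k h : Fin d) (x : Fin (n k)) (y : Fin (n j)) (s : Fin (n h)) : Idx n :=
  Function.update (Function.update (Function.update (fun _ => 0) k x) j y) h s

/-- The matrix `M^{h,v}_{j,k}`: contract the marginal on `{h, j, k}` with `v` in the mode `h`, and
take the entries with row index `(x, y)` at `(k, j)` and column index `(1, 1)` at `(k, j)`. -/
def probeMatrix (ρ : ThreeBody n) (j k h : Fin d) (v : Fin (n h) → ℂ) :
    Matrix (Fin (n k)) (Fin (n j)) ℂ :=
  Matrix.of fun x y => ∑ s, ∑ t, v s * conj (v t) *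
    ρ {h, j, k} Finset.card_le_three (fun l => idx3 j k h x y s l) (fun l => idx3 j k h 0 0 t l)

variable {r : ℕ}

/-- A choice of `n_k × r²` matrices, one for each pair `(k - 1, k)`. -/
abbrev Bases (n : Fin d → ℕ) (r : ℕ) : Type :=
  (k : Fin d) → Matrix (Fin (n k)) (Fin r × Fin r) ℂ

/-- `E k`, `E' k` are eigenbases for the nonzero spectra of the two products
`M^{h₁,v₁} (M^{h₂,v₂})†` and `M^{h₃,v₃} (M^{h₄,v₄})†` of the pair `(k - 1, k)`. -/
def IsEigenChoice (ρ : ThreeBody n) (p : Probes n) (E E' : Bases n r) : Prop :=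
  ∀ k : Fin d,
    IsEigenbasis (probeMatrix ρ (k - 1) k (p.site k 0) (p.vec k 0) *
      pinv (probeMatrix ρ (k - 1) k (p.site k 1) (p.vec k 1))) (E k) ∧
    IsEigenbasis (probeMatrix ρ (k - 1) k (p.site k 2) (p.vec k 2) *
      pinv (probeMatrix ρ (k - 1) k (p.site k 3) (p.vec k 3))) (E' k)

variable [NeZero r]

/-- The core `Q̂_k`, obtained from the pair `(k - 1, k)`: the column `(a, b)` of the unfolding
`⟨1⟩` holds the entries `(a, b)` of the slices. -/
def hatCore (E E' : Bases n r) : Cores n r :=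
  fun k α a b => hatUnfold (E k) (E' k) α (a, b)

/-- The core `Q̃_j`, obtained from the pair `(j, j + 1)`: its unfolding `[1]`, whose column `(b, a)`
holds the entries `(a, b)` of the slices, is the transpose of `Q̂_{j+1⟨1⟩}† M^{h₁,v₁}_{j,j+1}`. -/
def tildeCore (ρ : ThreeBody n) (p : Probes n) (E E' : Bases n r) : Cores n r :=
  fun j α a b => (pinv (hatUnfold (E (j + 1)) (E' (j + 1))) *
    probeMatrix ρ j (j + 1) (p.site (j + 1) 0) (p.vec (j + 1) 0))ᵀ α (b, a)

/-- The unfolding `[1]` of the `k`-th core. -/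
def unfoldSq (Q : Cores n r) (k : Fin d) : Matrix (Fin (n k)) (Fin r × Fin r) ℂ :=
  Matrix.of fun α ba => Q k α ba.2 ba.1

/-- `N_k`, the top-left `r × r` block of `Q̃_{k[1]}† Q̂_{k[1]}`. -/
def matN (ρ : ThreeBody n) (p : Probes n) (E E' : Bases n r) (k : Fin d) :
    Matrix (Fin r) (Fin r) ℂ :=
  Matrix.of fun a b =>
    (pinv (unfoldSq (tildeCore ρ p E E') k) * unfoldSq (hatCore E E') k) (0, a) (0, b)

/-- The output `Q̌_k = det(N_k⁻¹) • (Q̃_k ×₂ N_kᵀ)`, with slices `det(N_k⁻¹) • N_kᵀ Q̃_k^{(α)}`. -/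
def output (ρ : ThreeBody n) (p : Probes n) (E E' : Bases n r) : Cores n r :=
  fun k α => (((matN ρ p E E' k)⁻¹).det •
    ((matN ρ p E E' k)ᵀ * slice (tildeCore ρ p E E') k α) : Matrix (Fin r) (Fin r) ℂ)

/-- All the matrices that the algorithm inverts in the computation of `K̂` and of `Q̂` are
invertible. -/
def HatDefined (E E' : Bases n r) : Prop :=
  ∀ k : Fin d, (∀ l : Fin r, IsUnit (blockF (E k) (E' k) l 0).det) ∧
    IsUnit (Matrix.blockDiagonal (hatK (E k) (E' k))).det

/-- All the matrices `N_k` that the algorithm inverts are invertible. -/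
def GaugeDefined (ρ : ThreeBody n) (p : Probes n) (E E' : Bases n r) : Prop :=
  ∀ k : Fin d, IsUnit (matN ρ p E E' k).det

end Algorithm

end BlostrMPS

end

/-!
Contracting a probe `(h, v)` with a 3-body marginal gives `M = U (1 ⊗ X) W`, where `U` and `W` are
unfoldings of `Q_k` and `Q_{k-1}` and `X` is an `r × r` matrix depending on the probe. Generically
`U` and `W` have full rank and `X` is invertible, so `M₁ M₂† = U (1 ⊗ X₁ X₂⁻¹) U†`: its eigenbases
are `U (K_b ⊗ V e_b)` with `V` diagonalizing `X₁ X₂⁻¹` and `K_b` arbitrary invertible. Comparing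
with a second pair of probes, whose eigenvectors are in general position to `V`, ties the `K_b`
together up to scalars, and what remains is a gauge ambiguity for each pair of neighbouring sites;
`N_k` cancels the ambiguities of the two pairs that meet at site `k`.

All genericity conditions are non-vanishing conditions on real-analytic functions of the cores, so
each of them needs only one witness. It is found by perturbing: if every `X_i(ε)` is
`a_i (1 + ε B_i) + o(ε)`, then the trace-free part of the quotient `X₁ X₂⁻¹` is to first order a
multiple of that of `B₁ - B₂`, and the condition on the probes makes `B₁ - B₂` and `B₃ - B₄`
independently prescribable.
-/

namespace BlostrMPS

section ZeroSet

variable {E F : Type*} [NormedAddCommGroup E] [NormedSpace ℝ E] [NormedAddCommGroup F]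
  [NormedSpace ℝ F]

theorem countable_setOf_eq_zero_of_analyticOnNhd {f : ℝ → F}
    (hf : AnalyticOnNhd ℝ f Set.univ) {a : ℝ} (ha : f a ≠ 0) : {t | f t = 0}.Countable := by
  have hcodisc : (f ⁻¹' {0})ᶜ ∈ Filter.codiscrete ℝ := hf.preimage_zero_mem_codiscrete ha
  have hdisc : IsDiscrete (f ⁻¹' {0}) := by
    simpa only [Set.inter_univ] using isDiscrete_of_codiscreteWithin hcodisc
  exact (HereditarilyLindelofSpace.isLindelof _).countable_of_isDiscrete hdisc

theorem addHaar_eq_zero_of_ae_smul_notMem [FiniteDimensional ℝ E] [MeasurableSpace E]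
    [BorelSpace E] (ν : Measure E) [ν.IsAddHaarMeasure] {Z : Set E} (hZ : MeasurableSet Z)
    (h : ∀ x, ∀ᵐ t : ℝ, t • x ∉ Z) : ν Z = 0 := by
  have hmeas : MeasurableSet {q : E × ℝ | q.2 • q.1 ∉ Z} :=
    (measurable_snd.smul measurable_fst) hZ.compl
  have hswap : ∀ᵐ t : ℝ, ∀ᵐ x ∂ν, t • x ∉ Z :=
    (Measure.ae_ae_comm hmeas).1 (Filter.Eventually.of_forall h)
  obtain ⟨t, hZt, ht⟩ := (hswap.and (Measure.ae_ne volume (0 : ℝ))).exists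
  have hpre : ν ((t • ·) ⁻¹' Z) = 0 := by simpa [ae_iff] using! hZt
  rw [Measure.addHaar_preimage_smul ν ht] at hpre
  exact (mul_eq_zero.1 hpre).resolve_left (by simp [ht])

theorem ae_ne_zero_of_analyticOnNhd [FiniteDimensional ℝ E] [MeasurableSpace E] [BorelSpace E]
    (ν : Measure E) [ν.IsAddHaarMeasure] {f : E → F} (hf : AnalyticOnNhd ℝ f Set.univ) {x₀ : E}
    (h₀ : f x₀ ≠ 0) : ∀ᵐ x ∂ν, f x ≠ 0 := by
  have hnull : ν {x | f (x₀ + x) = 0} = 0 := by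
    refine addHaar_eq_zero_of_ae_smul_notMem ν (isClosed_eq
      (hf.continuous.comp (continuous_const.add continuous_id)) continuous_const).measurableSet
      fun x => ?_
    have hline : AnalyticOnNhd ℝ (fun t : ℝ => f (x₀ + t • x)) Set.univ := fun t _ =>
      (hf _ (Set.mem_univ _)).fun_comp (f := fun t : ℝ => x₀ + t • x) (by fun_prop)
    exact (countable_setOf_eq_zero_of_analyticOnNhd hline (a := 0) (by simpa using h₀)).ae_notMem _
  have htranslate : {x | ¬f x ≠ 0} = (-x₀ + ·) ⁻¹' {x | f (x₀ + x) = 0} := by ext; simp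
  rwa [ae_iff, htranslate, measure_preimage_add]

end ZeroSet

section AnalyticMat

variable {E : Type*} [NormedAddCommGroup E] [NormedSpace ℝ E] {l m n : Type*}

/-- A complex matrix depending on a parameter, all of whose entries are real-analytic functions of
the parameter. Analyticity is over `ℝ` because the algorithm conjugates. -/
def AnalyticMat (A : E → Matrix m n ℂ) : Prop :=
  ∀ i j, AnalyticOnNhd ℝ (fun x => A x i j) Set.univ

namespace AnalyticMat

theorem const (A : Matrix m n ℂ) : AnalyticMat fun _ : E => A :=
  fun _ _ => analyticOnNhd_const

theorem mul [Fintype m] {A : E → Matrix l m ℂ} {B : E → Matrix m n ℂ} (hA : AnalyticMat A)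
    (hB : AnalyticMat B) : AnalyticMat fun x => A x * B x := by
  intro i j
  simp only [Matrix.mul_apply]
  exact Finset.analyticOnNhd_fun_sum _ fun k _ => (hA i k).mul (hB k j)

theorem sub {A B : E → Matrix m n ℂ} (hA : AnalyticMat A) (hB : AnalyticMat B) :
    AnalyticMat fun x => A x - B x :=
  fun i j => (hA i j).sub (hB i j)

theorem sum {ι : Type*} (s : Finset ι) {A : ι → E → Matrix m n ℂ}
    (hA : ∀ i ∈ s, AnalyticMat (A i)) : AnalyticMat fun x => ∑ i ∈ s, A i x := by
  intro i j
  simp only [Matrix.sum_apply]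
  exact Finset.analyticOnNhd_fun_sum s fun k hk => hA k hk i j

theorem smul {f : E → ℂ} {A : E → Matrix m n ℂ} (hf : AnalyticOnNhd ℝ f Set.univ)
    (hA : AnalyticMat A) : AnalyticMat fun x => f x • A x :=
  fun i j => hf.mul (hA i j)

theorem conjTranspose {A : E → Matrix m n ℂ} (hA : AnalyticMat A) :
    AnalyticMat fun x => (A x)ᴴ :=
  fun i j x hx => (Complex.conjCLE.toContinuousLinearMap.analyticAt _).fun_comp (hA j i x hx)

variable [Fintype n]

theorem trace {A : E → Matrix n n ℂ} (hA : AnalyticMat A) :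
    AnalyticOnNhd ℝ (fun x => (A x).trace) Set.univ :=
  Finset.analyticOnNhd_fun_sum _ fun i _ => hA i i

variable [DecidableEq n]

theorem list_prod {ι : Type*} (L : List ι) {A : ι → E → Matrix n n ℂ}
    (hA : ∀ i, AnalyticMat (A i)) : AnalyticMat fun x => (L.map fun i => A i x).prod := by
  induction L with
  | nil => exact const 1
  | cons i L ih => simpa only [List.map_cons, List.prod_cons] using (hA i).mul ih

theorem pow {A : E → Matrix n n ℂ} (hA : AnalyticMat A) (k : ℕ) :
    AnalyticMat fun x => A x ^ k := by
  induction k with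
  | zero => simpa only [pow_zero] using const 1
  | succ k ih => simpa only [pow_succ] using ih.mul hA

theorem det {A : E → Matrix n n ℂ} (hA : AnalyticMat A) :
    AnalyticOnNhd ℝ (fun x => (A x).det) Set.univ := by
  simp only [Matrix.det_apply, Units.smul_def, zsmul_eq_mul]
  exact Finset.analyticOnNhd_fun_sum _ fun σ _ =>
    analyticOnNhd_const.mul (Finset.analyticOnNhd_fun_prod _ fun i _ => hA _ _)

theorem adjugate {A : E → Matrix n n ℂ} (hA : AnalyticMat A) :
    AnalyticMat fun x => (A x).adjugate := by
  intro i j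
  simp only [Matrix.adjugate_apply]
  refine det fun k l => ?_
  obtain rfl | hk := eq_or_ne k j
  · simpa only [updateRow_self] using analyticOnNhd_const
  · simpa only [updateRow_ne hk] using hA k l

end AnalyticMat

end AnalyticMat

section Pinv

variable {l m n : Type*} [Fintype m] [Fintype n] [DecidableEq n]

theorem isPinv_pinv (A : Matrix m n ℂ) : IsPinv A (pinv A) := (exists_isPinv A).choose_spec

theorem IsPinv.pinv_eq {A : Matrix m n ℂ} {B : Matrix n m ℂ} (h : IsPinv A B) : pinv A = B :=
  (isPinv_pinv A).unique h

theorem pinv_mul_self_of_isUnit {U : Matrix m n ℂ} (hU : IsUnit (Uᴴ * U).det) :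
    pinv U * U = 1 := by
  have hcancel : Uᴴ * U * (pinv U * U) = Uᴴ * U * 1 := by
    rw [Matrix.mul_one, Matrix.mul_assoc, ← Matrix.mul_assoc U, (isPinv_pinv U).aba]
  exact (isUnit_iff_isUnit_det _).2 hU |>.mul_left_cancel hcancel

theorem pinv_one : pinv (1 : Matrix n n ℂ) = 1 :=
  IsPinv.pinv_eq ⟨by simp, by simp, by simp, by simp⟩

theorem pinv_transpose [DecidableEq m] (A : Matrix m n ℂ) : pinv Aᵀ = (pinv A)ᵀ := by
  have h := isPinv_pinv A
  refine IsPinv.pinv_eq ⟨?_, ?_, ?_, ?_⟩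
  · rw [← transpose_mul, ← transpose_mul, ← Matrix.mul_assoc, h.aba]
  · rw [← transpose_mul, ← transpose_mul, ← Matrix.mul_assoc, h.bab]
  · rw [← transpose_mul, conjTranspose_transpose_eq_transpose_conjTranspose, h.herm_ba]
  · rw [← transpose_mul, conjTranspose_transpose_eq_transpose_conjTranspose, h.herm_ab]

theorem pinv_mul_mul [Fintype l] [DecidableEq l] {U : Matrix m n ℂ} {G : Matrix n n ℂ}
    {W : Matrix n l ℂ} (hU : pinv U * U = 1) (hG : IsUnit G.det) (hW : W * pinv W = 1) :
    pinv (U * G * W) = pinv W * G⁻¹ * pinv U := by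
  have hleft : U * G * W * (pinv W * G⁻¹ * pinv U) = U * pinv U := by
    calc U * G * W * (pinv W * G⁻¹ * pinv U)
        = U * (G * (W * pinv W * G⁻¹)) * pinv U := by simp only [Matrix.mul_assoc]
      _ = U * pinv U := by rw [hW, Matrix.one_mul, mul_nonsing_inv _ hG, Matrix.mul_one]
  have hright : pinv W * G⁻¹ * pinv U * (U * G * W) = pinv W * W := by
    calc pinv W * G⁻¹ * pinv U * (U * G * W)
        = pinv W * (G⁻¹ * (pinv U * U * G)) * W := by simp only [Matrix.mul_assoc]
      _ = pinv W * W := by rw [hU, Matrix.one_mul, nonsing_inv_mul _ hG, Matrix.mul_one]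
  refine IsPinv.pinv_eq ⟨?_, ?_, ?_, ?_⟩
  · rw [hleft, Matrix.mul_assoc U G, ← Matrix.mul_assoc (U * pinv U), (isPinv_pinv U).aba]
  · simp only [hright, ← Matrix.mul_assoc, (isPinv_pinv W).bab]
  · rw [hleft, (isPinv_pinv U).herm_ab]
  · rw [hright, (isPinv_pinv W).herm_ba]

theorem pinv_mul_of_isUnit {U : Matrix m n ℂ} {G : Matrix n n ℂ} (hU : pinv U * U = 1)
    (hG : IsUnit G.det) : pinv (U * G) = G⁻¹ * pinv U := by
  have h := pinv_mul_mul hU hG (W := (1 : Matrix n n ℂ)) (by rw [pinv_one, Matrix.mul_one])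
  rwa [pinv_one, Matrix.mul_one, Matrix.one_mul] at h

end Pinv

section Diagonalizes

variable {n 𝕜 : Type*} [Fintype n] [DecidableEq n] [Field 𝕜]

/-- The columns of the invertible matrix `V` are eigenvectors of `Y`, the `b`-th one for the
eigenvalue `lam b`, and these eigenvalues are distinct. -/
structure Diagonalizes (V Y : Matrix n n 𝕜) (lam : n → 𝕜) : Prop where
  isUnit_det : IsUnit V.det
  injective : Function.Injective lam
  mul_eq : Y * V = V * diagonal lam

theorem exists_diagonalizes {Y : Matrix n n 𝕜} {lam : n → 𝕜} (hinj : Function.Injective lam)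
    (hlam : ∀ b, Module.End.HasEigenvalue (toLin' Y) (lam b)) : ∃ V, Diagonalizes V Y lam := by
  choose v hv using fun b => (hlam b).exists_hasEigenvector
  refine ⟨(of v)ᵀ, ?_, hinj, ?_⟩
  · have hli := Module.End.eigenvectors_linearIndependent' (toLin' Y) lam hinj v hv
    rw [det_transpose, ← isUnit_iff_isUnit_det]
    exact linearIndependent_rows_iff_isUnit.1 hli
  · ext i b
    have hcol := congrFun (hv b).apply_eq_smul i
    rw [mul_diagonal, mul_comm]
    simpa [mulVec, dotProduct, Matrix.mul_apply] using hcol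

end Diagonalizes

section Amplification

variable {m n R : Type*} [DecidableEq m] [CommRing R]

/-- The matrix `1 ⊗ V`. The block index of Mathlib's `blockDiagonal` is the second index as well,
so that for diagonal `V` this commutes with every `blockDiagonal K`. -/
abbrev amplify (m : Type*) [DecidableEq m] (V : Matrix n n R) : Matrix (m × n) (m × n) R := 1 ⊗ₖ V

theorem amplify_mul [Fintype m] [Fintype n] (V W : Matrix n n R) :
    amplify m (V * W) = amplify m V * amplify m W := by
  rw [← mul_kronecker_mul, Matrix.one_mul]

variable [DecidableEq n]

theorem amplify_diagonal (lam : n → R) :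
    amplify m (diagonal lam) = diagonal fun q : m × n => lam q.2 := by
  rw [amplify, ← diagonal_one, diagonal_kronecker_diagonal]
  simp only [one_mul]

variable [Fintype m] [Fintype n]

theorem isUnit_det_kronecker {A : Matrix m m R} {B : Matrix n n R} (hA : IsUnit A.det)
    (hB : IsUnit B.det) : IsUnit (A ⊗ₖ B).det := by
  rw [det_kronecker]
  exact (hA.pow _).mul (hB.pow _)

theorem isUnit_det_amplify {V : Matrix n n R} (hV : IsUnit V.det) :
    IsUnit (amplify m V).det :=
  isUnit_det_kronecker (by rw [det_one]; exact isUnit_one) hV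

theorem amplify_inv (V : Matrix n n R) :
    (amplify m V)⁻¹ = amplify m V⁻¹ := by
  rw [inv_kronecker, inv_one]

theorem isUnit_det_blockDiagonal {K : n → Matrix m m R} (hK : ∀ b, IsUnit (K b).det) :
    IsUnit (blockDiagonal K).det := by
  rw [det_blockDiagonal]
  exact IsUnit.prod_univ_iff.2 hK

theorem blockDiagonal_inv {K : n → Matrix m m R} (hK : ∀ b, IsUnit (K b).det) :
    (blockDiagonal K)⁻¹ = blockDiagonal fun b => (K b)⁻¹ := by
  refine inv_eq_right_inv ?_
  simp only [← blockDiagonal_mul, mul_nonsing_inv _ (hK _)]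
  exact blockDiagonal_one

theorem amplify_mul_blockDiagonal_apply (V : Matrix n n R) (K : n → Matrix m m R) (a c : m)
    (b e : n) : (amplify m V * blockDiagonal K) (a, b) (c, e) = V b e * K e a c := by
  simp [Matrix.mul_apply, Fintype.sum_prod_type, one_apply, blockDiagonal_apply]

theorem commute_blockDiagonal_diagonal (K : n → Matrix m m R) (lam : n → R) :
    Commute (blockDiagonal K) (diagonal fun q : m × n => lam q.2) := by
  ext ⟨a, b⟩ ⟨c, e⟩
  by_cases h : b = e <;> simp [blockDiagonal_apply, h, mul_comm]

theorem eq_blockDiagonal_of_commute [IsDomain R] {W : Matrix (m × n) (m × n) R} {lam : n → R}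
    (hlam : Function.Injective lam) (hW : Commute W (diagonal fun q : m × n => lam q.2)) :
    W = blockDiagonal (blockDiag W) := by
  ext ⟨a, b⟩ ⟨c, e⟩
  rw [blockDiagonal_apply]
  split_ifs with h
  · obtain rfl : b = e := h
    rfl
  · have hentry := congrFun (congrFun hW.eq (a, b)) (c, e)
    simp only [mul_diagonal, diagonal_mul] at hentry
    have hzero : (lam e - lam b) * W (a, b) (c, e) = 0 := by linear_combination hentry
    exact (mul_eq_zero.1 hzero).resolve_left (sub_ne_zero.2 fun hbe => h (hlam hbe).symm)

end Amplification

section Eigenbasis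

variable {r m : ℕ}

theorem isUnit_det_of_linearIndependent_col_mul_blockDiagonal {ι m n 𝕜 : Type*} [Fintype m]
    [DecidableEq m] [Fintype n] [DecidableEq n] [Field 𝕜] {A : Matrix ι (m × n) 𝕜}
    {K : n → Matrix m m 𝕜} {b : n}
    (h : LinearIndependent 𝕜 fun a => (A * blockDiagonal K).col (a, b)) : IsUnit (K b).det := by
  have hcols : (A * blockDiagonal K).submatrix id (·, b) = A.submatrix id (·, b) * K b := by
    ext i a
    simp [Matrix.mul_apply, Fintype.sum_prod_type, blockDiagonal_apply]
  have hinj : Function.Injective (A.submatrix id (·, b) * K b).mulVec := by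
    rw [← hcols, mulVec_injective_iff]
    exact h
  rw [← isUnit_iff_isUnit_det, ← mulVec_injective_iff_isUnit]
  refine Function.Injective.of_comp (f := (A.submatrix id (·, b)).mulVec) fun x y hxy => hinj ?_
  simpa only [Function.comp_apply, mulVec_mulVec] using hxy

theorem linearIndependent_col_of_mul_eq_one {ι κ 𝕜 : Type*} [Fintype ι] [Finite κ]
    [DecidableEq κ] [CommRing 𝕜] {E : Matrix ι κ 𝕜} {L : Matrix κ ι 𝕜} (h : L * E = 1) :
    LinearIndependent 𝕜 E.col := by
  cases nonempty_fintype κ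
  rw [← mulVec_injective_iff]
  refine Function.LeftInverse.injective (g := L.mulVec) fun y => ?_
  rw [mulVec_mulVec, h, one_mulVec]

theorem exists_mulVec_eq_of_eigenvector {ι κ 𝕜 : Type*} [Fintype ι] [Fintype κ]
    [DecidableEq κ] [Field 𝕜] {E : Matrix ι κ 𝕜} {L : Matrix κ ι 𝕜} (h : L * E = 1)
    {w : κ → 𝕜} {x : ι → 𝕜} {z : 𝕜} (hz : z ≠ 0) (hx : (E * diagonal w * L) *ᵥ x = z • x) :
    ∃ y : κ → 𝕜, x = E *ᵥ y ∧ ∀ q, w q ≠ z → y q = 0 := by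
  have hLx : diagonal w *ᵥ (L *ᵥ x) = z • (L *ᵥ x) := by
    rw [← mulVec_smul, ← hx, mulVec_mulVec, mulVec_mulVec, ← Matrix.mul_assoc, ← Matrix.mul_assoc,
      h, Matrix.one_mul]
  refine ⟨L *ᵥ x, ?_, fun q hq => ?_⟩
  · have hzx : z • x = z • (E *ᵥ (L *ᵥ x)) := by
      rw [← mulVec_smul, ← hLx, ← hx]
      simp only [mulVec_mulVec, Matrix.mul_assoc]
    exact smul_right_injective _ hz hzx
  · have hq' := congrFun hLx q
    rw [mulVec_diagonal, Pi.smul_apply, smul_eq_mul] at hq'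
    have hzero : (w q - z) * (L *ᵥ x) q = 0 := by linear_combination hq'
    exact (mul_eq_zero.1 hzero).resolve_left (sub_ne_zero.2 hq)

theorem isEigenbasis_mul_diagonal_mul {E : Matrix (Fin m) (Fin r × Fin r) ℂ}
    {L : Matrix (Fin r × Fin r) (Fin m) ℂ} (h : L * E = 1) {lam : Fin r → ℂ}
    (hinj : Function.Injective lam) (hlam : ∀ b, lam b ≠ 0) :
    IsEigenbasis (E * diagonal (fun q : Fin r × Fin r => lam q.2) * L) E := by
  have hli : LinearIndependent ℂ E.col := linearIndependent_col_of_mul_eq_one h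
  have hmem : ∀ a b, E.col (a, b) ∈ Module.End.eigenspace
      (toLin' (E * diagonal (fun q : Fin r × Fin r => lam q.2) * L)) (lam b) := by
    intro a b
    rw [Module.End.mem_eigenspace_iff, toLin'_apply, ← mulVec_single_one, mulVec_mulVec,
      Matrix.mul_assoc _ L, h, Matrix.mul_one]
    ext i
    simp [mul_comm]
  refine ⟨lam, hinj, fun z => ⟨?_, ?_⟩, fun b =>
    ⟨hli.comp (fun a => (a, b)) (Prod.mk_left_injective b), le_antisymm ?_ fun x hx => ?_⟩⟩
  · rintro ⟨b, rfl⟩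
    exact ⟨hlam b, Module.End.hasEigenvalue_of_hasEigenvector ⟨hmem b b, hli.ne_zero (b, b)⟩⟩
  · rintro ⟨hz, hev⟩
    obtain ⟨x, hx⟩ := hev.exists_hasEigenvector
    obtain ⟨y, rfl, hy⟩ := exists_mulVec_eq_of_eigenvector h hz hx.apply_eq_smul
    by_contra hrange
    have hy0 : y = 0 := funext fun q => hy q fun hq => hrange ⟨q.2, hq⟩
    exact hx.2 (by rw [hy0, mulVec_zero])
  · rw [Submodule.span_le]
    rintro _ ⟨a, rfl⟩
    exact hmem a b
  · rw [Module.End.mem_eigenspace_iff] at hx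
    obtain ⟨y, rfl, hy⟩ := exists_mulVec_eq_of_eigenvector h (hlam b) hx
    simp only [mulVec_eq_sum, op_smul_eq_smul]
    refine Submodule.sum_mem _ fun q _ => ?_
    by_cases hq : q.2 = b
    · obtain ⟨a, e⟩ := q
      obtain rfl : e = b := hq
      exact Submodule.smul_mem _ _ (Submodule.subset_span (Set.mem_range_self a))
    · rw [hy q fun hlq => hq (hinj hlq), zero_smul]
      exact zero_mem _

theorem IsEigenbasis.exists_mul_eq {A : Matrix (Fin m) (Fin m) ℂ}
    {E : Matrix (Fin m) (Fin r × Fin r) ℂ} (h : IsEigenbasis A E) :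
    ∃ lam : Fin r → ℂ, Function.Injective lam ∧ (∀ b, lam b ≠ 0) ∧
      (∀ b, LinearIndependent ℂ fun a => E.col (a, b)) ∧
      A * E = E * diagonal (fun q : Fin r × Fin r => lam q.2) := by
  obtain ⟨lam, hinj, hrange, hbasis⟩ := h
  refine ⟨lam, hinj, fun b => ((hrange _).1 ⟨b, rfl⟩).1, fun b => (hbasis b).1, ?_⟩
  ext i ⟨a, b⟩
  have hmem : E.col (a, b) ∈ Module.End.eigenspace (toLin' A) (lam b) := by
    rw [← (hbasis b).2]
    exact Submodule.subset_span ⟨a, rfl⟩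
  rw [Module.End.mem_eigenspace_iff, toLin'_apply] at hmem
  rw [mul_diagonal, mul_comm]
  exact congrFun hmem i

/-- The columns `(a, b)` with fixed `b` are the images under `U` of the vectors `K_b e_a ⊗ V_b`,
where `V_b` is the `b`-th column of `V`. Every eigenbasis in the algorithm is of this form. -/
def eigenFrame {ι m n R : Type*} [Fintype m] [DecidableEq m] [Fintype n] [DecidableEq n]
    [CommRing R] (U : Matrix ι (m × n) R) (V : Matrix n n R) (K : n → Matrix m m R) :
    Matrix ι (m × n) R :=
  U * (amplify m V * blockDiagonal K)

variable {U : Matrix (Fin m) (Fin r × Fin r) ℂ}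

theorem isEigenbasis_eigenFrame (hU : pinv U * U = 1) {V Y : Matrix (Fin r) (Fin r) ℂ}
    {lam : Fin r → ℂ} (h : Diagonalizes V Y lam) (hlam : ∀ b, lam b ≠ 0)
    {K : Fin r → Matrix (Fin r) (Fin r) ℂ} (hK : ∀ b, IsUnit (K b).det) :
    IsEigenbasis (U * amplify (Fin r) Y * pinv U) (eigenFrame U V K) := by
  rw [eigenFrame]
  set W : Matrix (Fin r × Fin r) (Fin r × Fin r) ℂ := amplify (Fin r) V * blockDiagonal K with hW
  have hWdet : IsUnit W.det := by
    rw [hW, det_mul]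
    exact (isUnit_det_amplify h.isUnit_det).mul (isUnit_det_blockDiagonal hK)
  have hYW : W * diagonal (fun q : Fin r × Fin r => lam q.2) = amplify (Fin r) Y * W := by
    rw [hW, Matrix.mul_assoc, (commute_blockDiagonal_diagonal K lam).eq, ← amplify_diagonal,
      ← Matrix.mul_assoc, ← Matrix.mul_assoc, ← amplify_mul, ← amplify_mul, h.mul_eq]
  have hleft : W⁻¹ * pinv U * (U * W) = 1 := by
    rw [Matrix.mul_assoc, ← Matrix.mul_assoc (pinv U), hU, Matrix.one_mul, nonsing_inv_mul _ hWdet]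
  have hfactor : U * amplify (Fin r) Y * pinv U =
      U * W * diagonal (fun q : Fin r × Fin r => lam q.2) * (W⁻¹ * pinv U) := by
    rw [Matrix.mul_assoc U W, hYW, ← Matrix.mul_assoc _ W⁻¹, Matrix.mul_assoc U _ W⁻¹,
      mul_nonsing_inv_cancel_right _ _ hWdet]
  rw [hfactor]
  exact isEigenbasis_mul_diagonal_mul hleft h.injective hlam

theorem hasEigenvalue_of_amplify_mul {m n κ 𝕜 : Type*} [Fintype m] [DecidableEq m] [Fintype n]
    [DecidableEq n] [Fintype κ] [DecidableEq κ] [Field 𝕜] {Y : Matrix n n 𝕜}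
    {Z : Matrix (m × n) κ 𝕜} {w : κ → 𝕜} (hYZ : amplify m Y * Z = Z * diagonal w) {j : κ}
    (hj : Z.col j ≠ 0) : Module.End.HasEigenvalue (toLin' Y) (w j) := by
  obtain ⟨⟨a, c⟩, hc⟩ := Function.ne_iff.1 hj
  refine Module.End.hasEigenvalue_of_hasEigenvector (x := fun c => Z (a, c) j)
    ⟨Module.End.mem_eigenspace_iff.2 (funext fun e => ?_), fun h => hc (congrFun h c)⟩
  have hentry := congrFun (congrFun hYZ (a, e)) j
  rw [mul_diagonal, mul_comm] at hentry
  rw [toLin'_apply, Pi.smul_apply, smul_eq_mul, ← hentry]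
  simp [Matrix.mul_apply, Fintype.sum_prod_type, one_apply, mulVec, dotProduct]

theorem Diagonalizes.exists_eq_amplify_mul_blockDiagonal {m n 𝕜 : Type*} [Fintype m]
    [DecidableEq m] [Fintype n] [DecidableEq n] [Field 𝕜] {V Y : Matrix n n 𝕜} {lam : n → 𝕜}
    (hV : Diagonalizes V Y lam) {Z : Matrix (m × n) (m × n) 𝕜}
    (hYZ : amplify m Y * Z = Z * diagonal fun q => lam q.2) :
    ∃ K : n → Matrix m m 𝕜, Z = amplify m V * blockDiagonal K := by
  have hVdet : IsUnit (amplify m V).det := isUnit_det_amplify hV.isUnit_det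
  have hcomm : Commute ((amplify m V)⁻¹ * Z) (diagonal fun q => lam q.2) := by
    refine IsUnit.mul_left_cancel ((isUnit_iff_isUnit_det _).2 hVdet) ?_
    rw [Matrix.mul_assoc, mul_nonsing_inv_cancel_left _ _ hVdet, ← hYZ, ← Matrix.mul_assoc,
      ← amplify_diagonal, ← amplify_mul, ← hV.mul_eq, amplify_mul, Matrix.mul_assoc,
      mul_nonsing_inv_cancel_left _ _ hVdet]
  exact ⟨_, by rw [← eq_blockDiagonal_of_commute hV.injective hcomm,
    mul_nonsing_inv_cancel_left _ _ hVdet]⟩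

theorem IsEigenbasis.exists_eq_eigenFrame [NeZero r] (hU : pinv U * U = 1)
    {Y : Matrix (Fin r) (Fin r) ℂ} {E : Matrix (Fin m) (Fin r × Fin r) ℂ}
    (hE : IsEigenbasis (U * amplify (Fin r) Y * pinv U) E) :
    ∃ V lam, ∃ K : Fin r → Matrix (Fin r) (Fin r) ℂ, Diagonalizes V Y lam ∧
      (∀ b, IsUnit (K b).det) ∧ E = eigenFrame U V K := by
  obtain ⟨lam, hinj, hlam, hli, hAE⟩ := hE.exists_mul_eq
  set D : Matrix (Fin r × Fin r) (Fin r × Fin r) ℂ := diagonal fun q => lam q.2 with hD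
  have hDdet : IsUnit D.det := by
    rw [hD, det_diagonal]
    exact IsUnit.prod_univ_iff.2 fun q => (hlam q.2).isUnit
  have hYZ : amplify (Fin r) Y * (pinv U * E) = pinv U * E * D := by
    rw [Matrix.mul_assoc (pinv U), ← hAE]
    simp only [← Matrix.mul_assoc, hU, Matrix.one_mul]
  have hEZ : E = U * (pinv U * E) := by
    have hcancel : E * D = U * (pinv U * E) * D := by
      rw [Matrix.mul_assoc, ← hYZ, ← hAE]
      simp only [Matrix.mul_assoc]
    simpa only [mul_nonsing_inv_cancel_right _ _ hDdet]
      using congrArg (· * D⁻¹) hcancel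
  generalize pinv U * E = Z at hYZ hEZ
  have hcol : ∀ b, Z.col (0, b) ≠ 0 := fun b hzero => by
    refine (hli b).ne_zero 0 ?_
    rw [hEZ, ← mulVec_single_one, ← mulVec_mulVec, mulVec_single_one, hzero, mulVec_zero]
  have hev : ∀ b, Module.End.HasEigenvalue (toLin' Y) (lam b) := fun b =>
    hasEigenvalue_of_amplify_mul hYZ (j := (0, b)) (hcol b)
  obtain ⟨V, hV⟩ := BlostrMPS.exists_diagonalizes hinj hev
  obtain ⟨K, hZ⟩ := hV.exists_eq_amplify_mul_blockDiagonal hYZ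
  refine ⟨V, lam, K, hV, fun b => ?_, by rw [eigenFrame, ← hZ, ← hEZ]⟩
  refine isUnit_det_of_linearIndependent_col_mul_blockDiagonal (A := U * amplify (Fin r) V) ?_
  rw [Matrix.mul_assoc, ← hZ, ← hEZ]
  exact hli b

end Eigenbasis

section PairRecovery

variable {r m : ℕ} {U : Matrix (Fin m) (Fin r × Fin r) ℂ} {V V' : Matrix (Fin r) (Fin r) ℂ}
  {K K' : Fin r → Matrix (Fin r) (Fin r) ℂ}

theorem rotate_eigenFrame (G : Fin r → Fin r → Fin r → ℂ) :
    rotate G (eigenFrame U V K) = eigenFrame U V fun b => K b * of (G b) := by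
  rw [rotate, eigenFrame, eigenFrame, blockDiagonal_mul, Matrix.mul_assoc, Matrix.mul_assoc]

theorem pinv_eigenFrame (hU : pinv U * U = 1) (hV : IsUnit V.det) (hK : ∀ b, IsUnit (K b).det) :
    pinv (eigenFrame U V K) =
      blockDiagonal (fun b => (K b)⁻¹) * amplify (Fin r) V⁻¹ * pinv U := by
  have hdet : IsUnit (amplify (Fin r) V * blockDiagonal K).det := by
    rw [det_mul]
    exact (isUnit_det_amplify hV).mul (isUnit_det_blockDiagonal hK)
  rw [eigenFrame, pinv_mul_of_isUnit hU hdet, Matrix.mul_inv_rev, blockDiagonal_inv hK, amplify_inv]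

theorem blockF_eigenFrame (hU : pinv U * U = 1) (hV : IsUnit V.det)
    (hK : ∀ b, IsUnit (K b).det) (b c : Fin r) :
    blockF (eigenFrame U V K) (eigenFrame U V' K') b c =
      (V⁻¹ * V') b c • ((K b)⁻¹ * K' c) := by
  have hF : pinv (eigenFrame U V K) * eigenFrame U V' K' =
      blockDiagonal (fun b => (K b)⁻¹) * (amplify (Fin r) (V⁻¹ * V') * blockDiagonal K') := by
    rw [pinv_eigenFrame hU hV hK, eigenFrame, Matrix.mul_assoc _ (pinv U),
      ← Matrix.mul_assoc (pinv U), hU, Matrix.one_mul, amplify_mul]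
    simp only [Matrix.mul_assoc]
  ext a a'
  rw [blockF, of_apply, hF, Matrix.mul_apply, Fintype.sum_prod_type]
  simp only [amplify_mul_blockDiagonal_apply, blockDiagonal_apply, ite_mul, zero_mul,
    Finset.sum_ite_eq, Finset.mem_univ, if_true, Matrix.smul_apply, smul_eq_mul]
  rw [Matrix.mul_apply (M := (K b)⁻¹), Finset.mul_sum]
  exact Finset.sum_congr rfl fun _ _ => by ring

theorem isUnit_det_blockF_eigenFrame (hU : pinv U * U = 1) (hV : IsUnit V.det)
    (hK : ∀ b, IsUnit (K b).det) (hK' : ∀ b, IsUnit (K' b).det) {b c : Fin r}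
    (hbc : (V⁻¹ * V') b c ≠ 0) :
    IsUnit (blockF (eigenFrame U V K) (eigenFrame U V' K') b c).det := by
  rw [blockF_eigenFrame hU hV hK, det_smul, det_mul]
  exact (hbc.isUnit.pow _).mul ((isUnit_nonsing_inv_det _ (hK b)).mul (hK' c))

variable [NeZero r]

theorem hatK_eigenFrame (hU : pinv U * U = 1) (hV : IsUnit V.det) (hK : ∀ b, IsUnit (K b).det)
    (hK' : ∀ b, IsUnit (K' b).det) (hne : ∀ b, (V⁻¹ * V') b 0 ≠ 0) (l : Fin r) :
    hatK (eigenFrame U V K) (eigenFrame U V' K') l =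
      ((V⁻¹ * V') 0 0 / (V⁻¹ * V') l 0) • ((K 0)⁻¹ * K l) := by
  rw [hatK]
  split_ifs with hl
  · rw [hl, div_self (hne 0), one_smul, nonsing_inv_mul _ (hK 0)]
  · rw [blockF_eigenFrame hU hV hK, blockF_eigenFrame hU hV hK]
    have hinv : ((V⁻¹ * V') l 0 • ((K l)⁻¹ * K' 0))⁻¹ =
        ((V⁻¹ * V') l 0)⁻¹ • ((K' 0)⁻¹ * K l) := by
      refine inv_eq_right_inv ?_
      rw [Matrix.smul_mul, Matrix.mul_smul, smul_smul, mul_inv_cancel₀ (hne l), one_smul,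
        Matrix.mul_assoc, mul_nonsing_inv_cancel_left _ _ (hK' 0), nonsing_inv_mul _ (hK l)]
    rw [hinv, Matrix.smul_mul, Matrix.mul_smul, smul_smul, Matrix.mul_assoc,
      mul_nonsing_inv_cancel_left _ _ (hK' 0), div_eq_mul_inv]

theorem isUnit_det_hatK_eigenFrame (hU : pinv U * U = 1) (hV : IsUnit V.det)
    (hK : ∀ b, IsUnit (K b).det) (hK' : ∀ b, IsUnit (K' b).det)
    (hne : ∀ b, (V⁻¹ * V') b 0 ≠ 0) (l : Fin r) :
    IsUnit (hatK (eigenFrame U V K) (eigenFrame U V' K') l).det := by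
  rw [hatK_eigenFrame hU hV hK hK' hne, det_smul, det_mul]
  exact ((div_ne_zero (hne 0) (hne l)).isUnit.pow _).mul
    ((isUnit_nonsing_inv_det _ (hK 0)).mul (hK l))

/-- The matrix `B` such that the pair step recovers the slices `A Q_α B` from the eigenvectors
`V` and `V'`: the scaling that `K̂` leaves undetermined in the columns of `V` is the ratio
`(V⁻¹ V')_{l1} / (V⁻¹ V')_{11}`. -/
noncomputable def rightFactor (V V' : Matrix (Fin r) (Fin r) ℂ) : Matrix (Fin r) (Fin r) ℂ :=
  V * diagonal fun l => (V⁻¹ * V') l 0 / (V⁻¹ * V') 0 0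

theorem isUnit_det_rightFactor (hV : IsUnit V.det) (hne : ∀ b, (V⁻¹ * V') b 0 ≠ 0) :
    IsUnit (rightFactor V V').det := by
  rw [rightFactor, det_mul, det_diagonal]
  exact hV.mul (IsUnit.prod_univ_iff.2 fun l => (div_ne_zero (hne l) (hne 0)).isUnit)

theorem hatUnfold_eigenFrame (hU : pinv U * U = 1) (hV : IsUnit V.det)
    (hK : ∀ b, IsUnit (K b).det) (hK' : ∀ b, IsUnit (K' b).det)
    (hne : ∀ b, (V⁻¹ * V') b 0 ≠ 0) :
    hatUnfold (eigenFrame U V K) (eigenFrame U V' K') = U * (K 0 ⊗ₖ rightFactor V V') := by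
  set H := hatK (eigenFrame U V K) (eigenFrame U V' K') with hH
  have hHdet : IsUnit (blockDiagonal H).det :=
    isUnit_det_blockDiagonal (isUnit_det_hatK_eigenFrame hU hV hK hK' hne)
  set w : Fin r → ℂ := fun l => (V⁻¹ * V') l 0 / (V⁻¹ * V') 0 0
  have hblocks : K 0 ⊗ₖ diagonal w = blockDiagonal fun l => w l • K 0 := by
    ext ⟨a, b⟩ ⟨c, e⟩
    simp [diagonal_apply, blockDiagonal_apply, mul_comm]
  have hK_eq : blockDiagonal K = K 0 ⊗ₖ diagonal w * blockDiagonal H := by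
    rw [hblocks, ← blockDiagonal_mul]
    congr 1
    funext l
    rw [hH, hatK_eigenFrame hU hV hK hK' hne, Matrix.smul_mul, Matrix.mul_smul, smul_smul,
      mul_nonsing_inv_cancel_left _ _ (hK 0), div_mul_div_cancel₀ (hne 0), div_self (hne l),
      one_smul]
  calc eigenFrame U V K * (blockDiagonal H)⁻¹
      = U * (amplify (Fin r) V * (K 0 ⊗ₖ diagonal w)) := by
        rw [eigenFrame, hK_eq, ← Matrix.mul_assoc, ← Matrix.mul_assoc,
          mul_nonsing_inv_cancel_right _ _ hHdet, Matrix.mul_assoc]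
    _ = U * (K 0 ⊗ₖ rightFactor V V') := by rw [← mul_kronecker_mul, Matrix.one_mul, rightFactor]

end PairRecovery

section Unfolding

variable {d : ℕ} {n : Fin d → ℕ} {r : ℕ}

/-- The unfolding `⟨1⟩` of the `k`-th core. -/
def unfoldOne (Q : Cores n r) (k : Fin d) : Matrix (Fin (n k)) (Fin r × Fin r) ℂ :=
  of fun α ab => Q k α ab.1 ab.2

variable {Q Q' : Cores n r} {k : Fin d} {A B : Matrix (Fin r) (Fin r) ℂ}

theorem unfoldSq_eq_mul_kronecker_iff :
    unfoldSq Q' k = unfoldSq Q k * (B ⊗ₖ Aᵀ) ↔ ∀ α, slice Q' k α = A * slice Q k α * B := by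
  have hrow : ∀ α, (unfoldSq Q k * (B ⊗ₖ Aᵀ)) α = vec (A * slice Q k α * B) := fun α =>
    vec_vecMul_kronecker Aᵀ (slice Q k α) B
  have hrow' : ∀ α, unfoldSq Q' k α = vec (slice Q' k α) := fun _ => rfl
  refine funext_iff.trans (forall_congr' fun α => ?_)
  rw [hrow, hrow', vec_inj]

theorem unfoldOne_eq_mul_kronecker_iff :
    unfoldOne Q' k = unfoldOne Q k * (Aᵀ ⊗ₖ B) ↔ ∀ α, slice Q' k α = A * slice Q k α * B := by
  have hrow : ∀ α, (unfoldOne Q k * (Aᵀ ⊗ₖ B)) α = vec (A * slice Q k α * B)ᵀ := fun α => by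
    rw [transpose_mul, transpose_mul, ← Matrix.mul_assoc, ← vec_vecMul_kronecker]
    rfl
  have hrow' : ∀ α, unfoldOne Q' k α = vec (slice Q' k α)ᵀ := fun _ => rfl
  refine funext_iff.trans (forall_congr' fun α => ?_)
  rw [hrow, hrow', vec_inj, transpose_inj]

end Unfolding

section Recovery

variable {d : ℕ} {n : Fin d → ℕ} {r : ℕ} [NeZero r] {Q : Cores n r} {E E' : Bases n r}

theorem slice_hatCore {k : Fin d} {A B : Matrix (Fin r) (Fin r) ℂ}
    (h : hatUnfold (E k) (E' k) = unfoldOne Q k * (Aᵀ ⊗ₖ B)) (α : Fin (n k)) :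
    slice (hatCore E E') k α = A * slice Q k α * B :=
  (unfoldOne_eq_mul_kronecker_iff (Q' := hatCore E E')).1 h α

variable [NeZero d] [∀ k, NeZero (n k)] {ρ : ThreeBody n} {p : Probes n}

theorem slice_tildeCore {j : Fin d} {A B X : Matrix (Fin r) (Fin r) ℂ} (hA : IsUnit A.det)
    (hB : IsUnit B.det) (hU : pinv (unfoldOne Q (j + 1)) * unfoldOne Q (j + 1) = 1)
    (hhat : hatUnfold (E (j + 1)) (E' (j + 1)) = unfoldOne Q (j + 1) * (Aᵀ ⊗ₖ B))
    (hprobe : probeMatrix ρ j (j + 1) (p.site (j + 1) 0) (p.vec (j + 1) 0) =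
      unfoldOne Q (j + 1) * amplify (Fin r) X * (unfoldSq Q j)ᵀ) (α : Fin (n j)) :
    slice (tildeCore ρ p E E') j α = B⁻¹ * X * slice Q j α * A⁻¹ := by
  have hdet : IsUnit (Aᵀ ⊗ₖ B).det := isUnit_det_kronecker (isUnit_det_transpose A hA) hB
  have hunfold : pinv (hatUnfold (E (j + 1)) (E' (j + 1))) *
      probeMatrix ρ j (j + 1) (p.site (j + 1) 0) (p.vec (j + 1) 0) =
      ((A⁻¹)ᵀ ⊗ₖ (B⁻¹ * X)) * (unfoldSq Q j)ᵀ := by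
    rw [hhat, hprobe, pinv_mul_of_isUnit hU hdet, inv_kronecker, ← transpose_nonsing_inv,
      Matrix.mul_assoc, Matrix.mul_assoc, ← Matrix.mul_assoc (pinv _), hU, Matrix.one_mul,
      ← Matrix.mul_assoc, ← mul_kronecker_mul, Matrix.mul_one]
  refine unfoldSq_eq_mul_kronecker_iff.1 ?_ α
  calc unfoldSq (tildeCore ρ p E E') j
      = (((A⁻¹)ᵀ ⊗ₖ (B⁻¹ * X)) * (unfoldSq Q j)ᵀ)ᵀ := by rw [← hunfold]; rfl
    _ = unfoldSq Q j * (A⁻¹ ⊗ₖ (B⁻¹ * X)ᵀ) := by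
      rw [transpose_mul, transpose_transpose, ← kroneckerMap_transpose, transpose_transpose]

/-- The outcome of the pair steps: the cores `Q̂_k` are `A_k Q_k B_k`, and the first probe matrix
of each pair factors through the unfoldings of `Q`, with an invertible matrix `X_k` that comes from
the probe and from the cores of the sites other than `k - 1` and `k`. -/
structure PairRecovery (Q : Cores n r) (ρ : ThreeBody n) (p : Probes n) (E E' : Bases n r)
    (A B X : Fin d → Matrix (Fin r) (Fin r) ℂ) : Prop where
  isUnit_left : ∀ k, IsUnit (A k).det
  isUnit_right : ∀ k, IsUnit (B k).det
  isUnit_mid : ∀ k, IsUnit (X k).det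
  pinv_unfoldOne : ∀ k, pinv (unfoldOne Q k) * unfoldOne Q k = 1
  pinv_unfoldSq : ∀ k, pinv (unfoldSq Q k) * unfoldSq Q k = 1
  hatUnfold_eq : ∀ k, hatUnfold (E k) (E' k) = unfoldOne Q k * ((A k)ᵀ ⊗ₖ B k)
  probeMatrix_eq : ∀ j, probeMatrix ρ j (j + 1) (p.site (j + 1) 0) (p.vec (j + 1) 0) =
    unfoldOne Q (j + 1) * amplify (Fin r) (X (j + 1)) * (unfoldSq Q j)ᵀ

namespace PairRecovery

variable {A B X : Fin d → Matrix (Fin r) (Fin r) ℂ}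

theorem isUnit_det_inv_mul (h : PairRecovery Q ρ p E E' A B X) (k : Fin d) :
    IsUnit ((B k)⁻¹ * X k).det := by
  rw [det_mul]
  exact (isUnit_nonsing_inv_det _ (h.isUnit_right k)).mul (h.isUnit_mid k)

theorem slice_tildeCore (h : PairRecovery Q ρ p E E' A B X) (k : Fin d) (α : Fin (n k)) :
    slice (tildeCore ρ p E E') k α =
      (B (k + 1))⁻¹ * X (k + 1) * slice Q k α * (A (k + 1))⁻¹ :=
  BlostrMPS.slice_tildeCore (h.isUnit_left _) (h.isUnit_right _) (h.pinv_unfoldOne _)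
    (h.hatUnfold_eq _) (h.probeMatrix_eq k) α

theorem matN_eq (h : PairRecovery Q ρ p E E' A B X) (k : Fin d) :
    matN ρ p E E' k =
      (A (k + 1) * B k) 0 0 • (A k * ((B (k + 1))⁻¹ * X (k + 1))⁻¹)ᵀ := by
  have hYdet := h.isUnit_det_inv_mul (k + 1)
  have hhat := unfoldSq_eq_mul_kronecker_iff.2 (slice_hatCore (h.hatUnfold_eq k))
  have htilde := unfoldSq_eq_mul_kronecker_iff.2 (h.slice_tildeCore k)
  set Y := (B (k + 1))⁻¹ * X (k + 1)
  have hdet : IsUnit ((A (k + 1))⁻¹ ⊗ₖ Yᵀ).det :=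
    isUnit_det_kronecker (isUnit_nonsing_inv_det _ (h.isUnit_left _)) (isUnit_det_transpose Y hYdet)
  have hprod : pinv (unfoldSq (tildeCore ρ p E E') k) * unfoldSq (hatCore E E') k =
      (A (k + 1) * B k) ⊗ₖ (A k * Y⁻¹)ᵀ := by
    rw [hhat, htilde, pinv_mul_of_isUnit (h.pinv_unfoldSq k) hdet, inv_kronecker,
      nonsing_inv_nonsing_inv _ (h.isUnit_left _), ← transpose_nonsing_inv, Matrix.mul_assoc,
      ← Matrix.mul_assoc (pinv _), h.pinv_unfoldSq k, Matrix.one_mul, ← mul_kronecker_mul,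
      transpose_mul]
  ext a b
  rw [matN, of_apply, hprod]
  rfl

theorem isUnit_det_matN (h : PairRecovery Q ρ p E E' A B X) {k : Fin d}
    (hs : (A (k + 1) * B k) 0 0 ≠ 0) : IsUnit (matN ρ p E E' k).det := by
  rw [h.matN_eq, det_smul, det_transpose, det_mul]
  exact (hs.isUnit.pow _).mul ((h.isUnit_left k).mul
    (isUnit_nonsing_inv_det _ (h.isUnit_det_inv_mul _)))

theorem exists_slice_output (h : PairRecovery Q ρ p E E' A B X) (hN : GaugeDefined ρ p E E') :
    ∃ (σ : Fin d → ℂˣ) (L : Fin d → GL (Fin r) ℂ), ∀ k α, slice (output ρ p E E') k α =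
      (σ k : ℂ) • (((L k)⁻¹ : GL (Fin r) ℂ).val * slice Q k α * (L (k + 1)).val) := by
  have hσ : ∀ k, ((matN ρ p E E' k)⁻¹).det * (A (k + 1) * B k) 0 0 ≠ 0 := by
    refine fun k => mul_ne_zero (isUnit_nonsing_inv_det _ (hN k)).ne_zero fun hs =>
      (hN k).ne_zero ?_
    rw [h.matN_eq, hs, zero_smul, det_zero]
  refine ⟨fun k => Units.mk0 _ (hσ k), fun k => (nonsingInvUnit _ (h.isUnit_left k))⁻¹,
    fun k α => ?_⟩
  rw [inv_inv, coe_units_inv, Units.val_mk0]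
  change _ = _ • (A k * slice Q k α * (A (k + 1))⁻¹)
  have hYdet := h.isUnit_det_inv_mul (k + 1)
  have htilde := h.slice_tildeCore k α
  have hNt := congrArg transpose (h.matN_eq k)
  set Y := (B (k + 1))⁻¹ * X (k + 1)
  rw [transpose_smul, transpose_transpose] at hNt
  calc slice (output ρ p E E') k α
      = ((matN ρ p E E' k)⁻¹).det • ((matN ρ p E E' k)ᵀ * slice (tildeCore ρ p E E') k α) := rfl
    _ = _ := by
      rw [htilde, hNt, Matrix.smul_mul, smul_smul]
      simp only [← Matrix.mul_assoc, nonsing_inv_mul_cancel_right _ _ hYdet]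

end PairRecovery

end Recovery

section Gauge

variable {d : ℕ} {n : Fin d → ℕ} {r : ℕ}

theorem prod_ofFn_telescope {R : Type*} [Monoid R] (m : ℕ) (g : Fin m → R) (L : ℕ → Rˣ) :
    (List.ofFn fun i : Fin m => ((L i)⁻¹ : Rˣ).val * g i * (L (i + 1)).val).prod =
      ((L 0)⁻¹ : Rˣ).val * (List.ofFn g).prod * (L m).val := by
  induction m with
  | zero => simp
  | succ m ih =>
    rw [List.ofFn_succ', List.ofFn_succ', List.concat_eq_append, List.concat_eq_append,
      List.prod_append, List.prod_append]
    have hinit := ih fun i => g i.castSucc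
    simp only [Fin.val_castSucc, List.prod_singleton, Fin.val_last] at hinit ⊢
    rw [hinit]
    simp only [mul_assoc, Units.mul_inv_cancel_left]

theorem exists_cyclic_ratio [NeZero d] {G : Type*} [CommGroup G] {σ : Fin d → G}
    (hσ : ∏ k, σ k = 1) : ∃ t : Fin d → G, ∀ k, t (k + 1) = t k * σ k := by
  obtain ⟨D, rfl⟩ := Nat.exists_eq_succ_of_ne_zero (NeZero.ne d)
  have hIic : ∀ k, (∏ l ∈ Finset.Iio k, σ l) * σ k = ∏ l ∈ Finset.Iic k, σ l := fun k => by
    rw [← Finset.Iio_insert, Finset.prod_insert (by simp), mul_comm]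
  refine ⟨fun k => ∏ l ∈ Finset.Iio k, σ l, Fin.lastCases ?_ fun i => ?_⟩
  · have huniv : Finset.Iic (Fin.last D) = Finset.univ := by ext l; simp [Fin.le_last]
    rw [hIic, huniv, hσ, Fin.last_add_one]
    exact Finset.prod_eq_one fun l hl => absurd (Finset.mem_Iio.1 hl) (by simp)
  · have hIio : Finset.Iio i.succ = Finset.Iic i.castSucc := by
      ext l; simp [Fin.lt_def, Fin.le_def]
    rw [hIic, Fin.coeSucc_eq_succ, ← hIio]

theorem gaugeEquiv_of_slice_eq_smul [NeZero d] {Q Q' : Cores n r} {L : Fin d → GL (Fin r) ℂ}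
    {σ : Fin d → ℂˣ} (hσ : ∏ k, σ k = 1)
    (h : ∀ k α, slice Q' k α =
      (σ k : ℂ) • (((L k)⁻¹ : GL (Fin r) ℂ).val * slice Q k α * (L (k + 1)).val)) :
    GaugeEquiv Q Q' := by
  obtain ⟨t, ht⟩ := exists_cyclic_ratio hσ
  refine ⟨fun k => t k • L k, fun k α => ?_⟩
  have hinv : ((t k • L k)⁻¹ : GL (Fin r) ℂ).val = (t k : ℂ)⁻¹ • ((L k)⁻¹ : GL (Fin r) ℂ).val := by
    rw [← Units.val_inv_eq_inv_val]
    rfl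
  have hnext : (t (k + 1) • L (k + 1)).val = ((t k : ℂ) * σ k) • (L (k + 1)).val := by
    rw [ht, ← Units.val_mul]
    rfl
  rw [h, hinv, hnext, Matrix.smul_mul, Matrix.smul_mul, Matrix.mul_smul, smul_smul,
    inv_mul_cancel_left₀ (t k).ne_zero]

theorem slice_scaleFirst [NeZero d] (c : ℂ) (Q : Cores n r) (k : Fin d) (α : Fin (n k)) :
    slice (scaleFirst c Q) k α = (if k = 0 then c else 1) • slice Q k α := rfl

theorem exists_scaleFirst_gaugeEquiv [NeZero d] {Q Q' : Cores n r} {L : Fin d → GL (Fin r) ℂ}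
    {σ : Fin d → ℂˣ}
    (h : ∀ k α, slice Q' k α =
      (σ k : ℂ) • (((L k)⁻¹ : GL (Fin r) ℂ).val * slice Q k α * (L (k + 1)).val)) :
    ∃ c : ℂ, c ≠ 0 ∧ GaugeEquiv Q (scaleFirst c Q') := by
  set c : ℂˣ := (∏ k, σ k)⁻¹ with hc
  refine ⟨c, c.ne_zero, gaugeEquiv_of_slice_eq_smul (L := L)
    (σ := fun k => (if k = 0 then c else 1) * σ k) ?_ fun k α => ?_⟩
  · rw [Finset.prod_mul_distrib, Finset.prod_ite_eq' Finset.univ 0 fun _ => c,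
      if_pos (Finset.mem_univ _), hc, inv_mul_cancel]
  · rw [slice_scaleFirst, h, smul_smul]
    split_ifs <;> simp

theorem ringTensor_eq_of_gaugeEquiv [NeZero d] {Q Q' : Cores n r} (h : GaugeEquiv Q Q')
    (α : Idx n) : ringTensor Q' α = ringTensor Q α := by
  obtain ⟨L, hL⟩ := h
  have hprod := prod_ofFn_telescope d (fun k => slice Q k (α k)) fun i => L (Fin.ofNat d i)
  have hval : ∀ k : Fin d, Fin.ofNat d k = k := fun k => by
    ext; simp [Fin.ofNat, Nat.mod_eq_of_lt k.isLt]
  have hsucc : ∀ k : Fin d, Fin.ofNat d (k + 1) = k + 1 := fun k => by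
    ext; simp [Fin.ofNat, Fin.val_add]
  have hend : Fin.ofNat d d = Fin.ofNat d 0 := by ext; simp [Fin.ofNat]
  simp only [hval, hsucc, hend, ← hL] at hprod
  rw [ringTensor, hprod, Matrix.trace_mul_comm, ← Matrix.mul_assoc, Units.mul_inv,
    Matrix.one_mul, ringTensor]

theorem ringTensor_scaleFirst [NeZero d] (c : ℂ) (Q : Cores n r) (α : Idx n) :
    ringTensor (scaleFirst c Q) α = c * ringTensor Q α := by
  obtain ⟨D, rfl⟩ := Nat.exists_eq_succ_of_ne_zero (NeZero.ne d)
  simp only [ringTensor, List.ofFn_succ, List.prod_cons, slice_scaleFirst, if_true,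
    Fin.succ_ne_zero, if_false, one_smul, Matrix.smul_mul, trace_smul, smul_eq_mul]

theorem exists_phase_mpsState {Q Q' : Cores n r} {c : ℂ} (hc : c ≠ 0)
    (h : ∀ α, ringTensor Q' α = c * ringTensor Q α) :
    ∃ z : ℂ, ‖z‖ = 1 ∧ ∀ α, mpsState Q' α = z * mpsState Q α := by
  have hnorm : (‖c‖ : ℂ) ≠ 0 := by exact_mod_cast norm_ne_zero_iff.2 hc
  refine ⟨c / ‖c‖, by simp [hc], fun α => ?_⟩
  have hsqrt : √(∑ β, ‖ringTensor Q' β‖ ^ 2) = ‖c‖ * √(∑ β, ‖ringTensor Q β‖ ^ 2) := by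
    simp only [h, norm_mul, mul_pow]
    rw [← Finset.mul_sum, Real.sqrt_mul (by positivity), Real.sqrt_sq (norm_nonneg c)]
  rw [mpsState, mpsState, hsqrt, h α]
  push_cast
  rw [mul_inv]
  field_simp

theorem exists_phase_mpsState_of_gaugeEquiv [NeZero d] {Q Q' : Cores n r} {c : ℂ} (hc : c ≠ 0)
    (h : GaugeEquiv Q (scaleFirst c Q')) :
    ∃ z : ℂ, ‖z‖ = 1 ∧ ∀ α, mpsState Q' α = z * mpsState Q α := by
  refine exists_phase_mpsState (inv_ne_zero hc) fun α => ?_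
  rw [← ringTensor_eq_of_gaugeEquiv h, ringTensor_scaleFirst, inv_mul_cancel_left₀ hc]

theorem sum_norm_sq_mpsState {Q : Cores n r} {α : Idx n} (h : ringTensor Q α ≠ 0) :
    ∑ β, ‖mpsState Q β‖ ^ 2 = 1 := by
  have hpos : 0 < ∑ β, ‖ringTensor Q β‖ ^ 2 :=
    Finset.sum_pos' (fun _ _ => by positivity) ⟨α, Finset.mem_univ _, by positivity⟩
  simp only [mpsState, norm_mul, mul_pow]
  rw [← Finset.mul_sum, norm_inv, Complex.norm_real, Real.norm_eq_abs,
    abs_of_nonneg (Real.sqrt_nonneg _), inv_pow, Real.sq_sqrt hpos.le, inv_mul_cancel₀ hpos.ne']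

end Gauge

section Cyclic

variable {d : ℕ} [NeZero d]

/-- All the sites in cyclic order, starting with `k - 1`. -/
noncomputable def cyclicSites (k : Fin d) : List (Fin d) := (List.finRange d).rotate (k - 1).val

/-- All the sites except `k - 1` and `k`, in cyclic order, starting with `k + 1`. -/
noncomputable def restSites (k : Fin d) : List (Fin d) := (cyclicSites k).drop 2

theorem nodup_cyclicSites (k : Fin d) : (cyclicSites k).Nodup :=
  List.nodup_rotate.2 (List.nodup_finRange d)

theorem cyclicSites_eq_cons_cons (hd : 2 ≤ d) (k : Fin d) :
    cyclicSites k = (k - 1) :: k :: restSites k := by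
  have hlen : (cyclicSites k).length = d := by simp [cyclicSites]
  have hzero : (cyclicSites k)[0]'(by omega) = k - 1 := by
    ext
    simp [cyclicSites, List.getElem_rotate, Nat.mod_eq_of_lt (k - 1).isLt]
  have hone : (cyclicSites k)[1]'(by omega) = k := by
    have hval := congrArg Fin.val (sub_add_cancel k 1)
    rw [Fin.val_add] at hval
    ext
    simp only [cyclicSites, List.getElem_rotate, List.length_finRange, List.getElem_finRange,
      Fin.val_cast]
    rw [add_comm, ← hval]
    simp
  rw [restSites, ← hzero]
  conv_rhs => enter [2, 1]; rw [← hone]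
  rw [← List.drop_eq_getElem_cons, ← List.drop_eq_getElem_cons, List.drop_zero]

theorem ne_of_mem_restSites (hd : 2 ≤ d) {k l : Fin d} (h : l ∈ restSites k) :
    l ≠ k - 1 ∧ l ≠ k := by
  have hnodup := nodup_cyclicSites k
  rw [cyclicSites_eq_cons_cons hd, List.nodup_cons, List.nodup_cons] at hnodup
  exact ⟨fun e => hnodup.1 (e ▸ List.mem_cons_of_mem _ h), fun e => hnodup.2.1 (e ▸ h)⟩

end Cyclic

section Probe

variable {d : ℕ} [NeZero d] {n : Fin d → ℕ} {r : ℕ}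

/-- Multi-indices of the sites other than `h`, `k - 1` and `k`. -/
abbrev EnvIdx (n : Fin d → ℕ) (k h : Fin d) : Type :=
  (l : {l : Fin d // l ∉ ({h, k - 1, k} : Finset (Fin d))}) → Fin (n l)

/-- The product of the slices at the sites other than `k - 1` and `k`, in cyclic order. -/
noncomputable def restProd (Q : Cores n r) (k : Fin d) (α : Idx n) : Matrix (Fin r) (Fin r) ℂ :=
  ((restSites k).map fun l => slice Q l (α l)).prod

theorem restProd_congr (hd : 2 ≤ d) (Q : Cores n r) {k : Fin d} {α β : Idx n}
    (h : ∀ l, l ≠ k - 1 → l ≠ k → α l = β l) : restProd Q k α = restProd Q k β := by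
  refine congrArg List.prod (List.map_congr_left fun l hl => ?_)
  rw [h l (ne_of_mem_restSites hd hl).1 (ne_of_mem_restSites hd hl).2]

theorem ringTensor_eq_trace_restProd (hd : 2 ≤ d) (Q : Cores n r) (k : Fin d) (α : Idx n) :
    ringTensor Q α =
      (slice Q (k - 1) (α (k - 1)) * slice Q k (α k) * restProd Q k α).trace := by
  have hcyclic : ringTensor Q α = ((cyclicSites k).map fun l => slice Q l (α l)).prod.trace := by
    rw [ringTensor, List.ofFn_eq_map, cyclicSites, List.map_rotate,
      List.rotate_eq_drop_append_take_mod, List.prod_append, Matrix.trace_mul_comm,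
      ← List.prod_append, List.take_append_drop]
  rw [hcyclic, cyclicSites_eq_cons_cons hd, List.map_cons, List.map_cons, List.prod_cons,
    List.prod_cons, Matrix.mul_assoc]
  rfl

omit [NeZero d] in
theorem unfoldOne_mul_amplify_mul_unfoldSq_apply (Q : Cores n r) (j k : Fin d)
    (X : Matrix (Fin r) (Fin r) ℂ) (x : Fin (n k)) (y : Fin (n j)) :
    (unfoldOne Q k * amplify (Fin r) X * (unfoldSq Q j)ᵀ) x y =
      (slice Q j y * slice Q k x * X).trace := by
  have hmid : ∀ a c, (unfoldOne Q k * amplify (Fin r) X) x (a, c) = (slice Q k x * X) a c :=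
    fun a c => by
      simp [Matrix.mul_apply, amplify, Fintype.sum_prod_type, one_apply, unfoldOne, slice]
  rw [Matrix.mul_assoc (slice Q j y), Matrix.mul_apply, Fintype.sum_prod_type, Matrix.trace,
    Finset.sum_comm]
  refine Finset.sum_congr rfl fun c _ => ?_
  rw [diag_apply, Matrix.mul_apply]
  refine Finset.sum_congr rfl fun a _ => ?_
  rw [hmid, mul_comm]
  rfl

variable [∀ k, NeZero (n k)]

omit [NeZero d] in
theorem probeMatrix_threeBody_apply (ψ : Idx n → ℂ) (j k h : Fin d) (v : Fin (n h) → ℂ)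
    (x : Fin (n k)) (y : Fin (n j)) :
    probeMatrix (threeBody ψ) j k h v x y =
      ∑ c, (∑ s, v s * ψ (glue {h, j, k} (fun l => idx3 j k h x y s l) c)) *
        conj (∑ t, v t * ψ (glue {h, j, k} (fun l => idx3 j k h 0 0 t l) c)) := by
  simp only [probeMatrix, threeBody, marginal, of_apply, Finset.mul_sum]
  simp only [map_sum, map_mul, Finset.sum_mul_sum]
  conv_rhs => rw [Finset.sum_comm]
  refine Finset.sum_congr rfl fun s _ => ?_
  conv_rhs => rw [Finset.sum_comm]
  exact Finset.sum_congr rfl fun t _ => Finset.sum_congr rfl fun c _ => by ring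

/-- The multi-index with the first index at `k - 1` and `k`, `s` at `h` and `c` elsewhere. -/
def probeIdx (k h : Fin d) (c : EnvIdx n k h) (s : Fin (n h)) : Idx n :=
  glue {h, k - 1, k} (fun l => idx3 (k - 1) k h 0 0 s l) c

/-- The product of the slices off `k - 1` and `k` at the indices `c`, contracted with `v` at the
site `h`. -/
noncomputable def probeProd (Q : Cores n r) (k h : Fin d) (v : Fin (n h) → ℂ) (c : EnvIdx n k h) :
    Matrix (Fin r) (Fin r) ℂ :=
  ∑ s, v s • restProd Q k (probeIdx k h c s)

/-- The `r × r` matrix through which the probe matrix of `(h, v)` at the pair `(k - 1, k)` factors,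
up to the normalization of the state. -/
noncomputable def probeCore (Q : Cores n r) (k h : Fin d) (v : Fin (n h) → ℂ) :
    Matrix (Fin r) (Fin r) ℂ :=
  ∑ c, conj ((slice Q (k - 1) 0 * slice Q k 0 * probeProd Q k h v c).trace) • probeProd Q k h v c

theorem ringTensor_glue (hd : 2 ≤ d) (Q : Cores n r) {k h : Fin d} (h₁ : h ≠ k - 1) (h₂ : h ≠ k)
    (c : EnvIdx n k h) (x : Fin (n k)) (y : Fin (n (k - 1))) (s : Fin (n h)) :
    ringTensor Q (glue {h, k - 1, k} (fun l => idx3 (k - 1) k h x y s l) c) =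
      (slice Q (k - 1) y * slice Q k x * restProd Q k (probeIdx k h c s)).trace := by
  have hne : k - 1 ≠ k := fun e => by
    have hone := congrArg Fin.val (sub_eq_self.1 e)
    rw [Fin.val_one', Fin.val_zero, Nat.mod_eq_of_lt (by omega)] at hone
    omega
  have hleft : glue {h, k - 1, k} (fun l => idx3 (k - 1) k h x y s l) c (k - 1) = y := by
    simp [glue, idx3, Function.update_of_ne h₁.symm]
  have hright : glue {h, k - 1, k} (fun l => idx3 (k - 1) k h x y s l) c k = x := by
    simp [glue, idx3, Function.update_of_ne h₂.symm, Function.update_of_ne hne.symm]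
  have hrest : restProd Q k (glue {h, k - 1, k} (fun l => idx3 (k - 1) k h x y s l) c) =
      restProd Q k (probeIdx k h c s) := by
    refine restProd_congr hd Q fun l hl₁ hl₂ => ?_
    by_cases hl : l = h
    · subst hl; simp [probeIdx, glue, idx3]
    · simp [probeIdx, glue, hl, hl₁, hl₂]
  rw [ringTensor_eq_trace_restProd hd Q k, hleft, hright, hrest]

/-- The inverse of the squared norm of the tensor. -/
noncomputable def normFactor (Q : Cores n r) : ℂ :=
  ((Real.sqrt (∑ β, ‖ringTensor Q β‖ ^ 2) : ℝ) : ℂ)⁻¹ ^ 2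

omit [NeZero d] [∀ k, NeZero (n k)] in
theorem normFactor_ne_zero {Q : Cores n r} {α : Idx n} (h : ringTensor Q α ≠ 0) :
    normFactor Q ≠ 0 := by
  have hpos : 0 < ∑ β, ‖ringTensor Q β‖ ^ 2 :=
    Finset.sum_pos' (fun _ _ => by positivity) ⟨α, Finset.mem_univ _, by positivity⟩
  exact pow_ne_zero 2 (inv_ne_zero (Complex.ofReal_ne_zero.2 (Real.sqrt_ne_zero'.2 hpos)))

theorem sum_mul_mpsState_glue (hd : 2 ≤ d) (Q : Cores n r) {k h : Fin d} (h₁ : h ≠ k - 1)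
    (h₂ : h ≠ k) (v : Fin (n h) → ℂ) (c : EnvIdx n k h) (x : Fin (n k))
    (y : Fin (n (k - 1))) :
    ∑ s, v s * mpsState Q (glue {h, k - 1, k} (fun l => idx3 (k - 1) k h x y s l) c) =
      ((Real.sqrt (∑ β, ‖ringTensor Q β‖ ^ 2) : ℝ) : ℂ)⁻¹ *
        (slice Q (k - 1) y * slice Q k x * probeProd Q k h v c).trace := by
  simp only [mpsState, ringTensor_glue hd Q h₁ h₂, probeProd, Finset.mul_sum, trace_sum,
    Matrix.mul_smul, trace_smul, smul_eq_mul]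
  exact Finset.sum_congr rfl fun s _ => mul_left_comm _ _ _

theorem probeMatrix_mpsState (hd : 2 ≤ d) (Q : Cores n r) {k h : Fin d} (h₁ : h ≠ k - 1)
    (h₂ : h ≠ k) (v : Fin (n h) → ℂ) :
    probeMatrix (threeBody (mpsState Q)) (k - 1) k h v =
      unfoldOne Q k * amplify (Fin r) (normFactor Q • probeCore Q k h v) *
        (unfoldSq Q (k - 1))ᵀ := by
  ext x y
  rw [unfoldOne_mul_amplify_mul_unfoldSq_apply, probeMatrix_threeBody_apply]
  simp only [sum_mul_mpsState_glue hd Q h₁ h₂, probeCore, Finset.smul_sum, Matrix.mul_sum,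
    trace_sum, Matrix.mul_smul, trace_smul, smul_eq_mul, normFactor, map_mul, map_inv₀,
    Complex.conj_ofReal]
  exact Finset.sum_congr rfl fun c _ => by ring

end Probe

section AnalyticCores

variable {d : ℕ} {n : Fin d → ℕ} {r : ℕ}

theorem analyticMat_slice (k : Fin d) (α : Fin (n k)) :
    AnalyticMat fun Q : Cores n r => slice Q k α := fun i j =>
  ((ContinuousLinearMap.proj (R := ℝ) (φ := fun _ : Fin r => ℂ) j).comp
    ((ContinuousLinearMap.proj (R := ℝ) (φ := fun _ : Fin r => Fin r → ℂ) i).comp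
      ((ContinuousLinearMap.proj (R := ℝ) (φ := fun _ : Fin (n k) => Fin r → Fin r → ℂ) α).comp
        (ContinuousLinearMap.proj (R := ℝ)
          (φ := fun k : Fin d => Fin (n k) → Fin r → Fin r → ℂ) k)))).analyticOnNhd _

theorem analyticMat_unfoldOne (k : Fin d) : AnalyticMat fun Q : Cores n r => unfoldOne Q k :=
  fun α ab => analyticMat_slice k α ab.1 ab.2

variable [NeZero d] [∀ k, NeZero (n k)]

theorem analyticMat_probeProd (k h : Fin d) (v : Fin (n h) → ℂ) (c : EnvIdx n k h) :
    AnalyticMat fun Q : Cores n r => probeProd Q k h v c :=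
  AnalyticMat.sum _ fun s _ => AnalyticMat.smul analyticOnNhd_const
    (AnalyticMat.list_prod (restSites k) fun l => analyticMat_slice l (probeIdx k h c s l))

theorem analyticMat_probeCore (k h : Fin d) (v : Fin (n h) → ℂ) :
    AnalyticMat fun Q : Cores n r => probeCore Q k h v := by
  refine AnalyticMat.sum _ fun c _ => AnalyticMat.smul ?_ (analyticMat_probeProd k h v c)
  simpa only [trace_conjTranspose, RCLike.star_def] using
    (((analyticMat_slice _ _).mul (analyticMat_slice _ _)).mul
      (analyticMat_probeProd k h v c)).conjTranspose.trace

end AnalyticCores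

section Spectrum

variable {r : ℕ}

section CommRing

variable {R : Type*} [CommRing R]

/-- The Hankel matrix of the power traces of `A`. Its determinant is the discriminant of
the characteristic polynomial, so it detects a simple spectrum. -/
def hankel (A : Matrix (Fin r) (Fin r) R) : Matrix (Fin r) (Fin r) R :=
  of fun i j => (A ^ (i.val + j.val)).trace

/-- The matrix with the words `A ^ j * A' ^ i` as rows. If it is invertible, then these words span
the full matrix algebra, and the eigenvectors of `A` and `A'` are in general position. -/
def wordMatrix (A A' : Matrix (Fin r) (Fin r) R) : Matrix (Fin r × Fin r) (Fin r × Fin r) R :=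
  of fun ji ab => (A ^ ji.1.val * A' ^ ji.2.val) ab.1 ab.2

/-- The trace-free part of `A` multiplied by `r`, which avoids a division. -/
def traceFree (A : Matrix (Fin r) (Fin r) R) : Matrix (Fin r) (Fin r) R :=
  (r : R) • A - A.trace • (1 : Matrix (Fin r) (Fin r) R)

theorem traceFree_smul (c : R) (A : Matrix (Fin r) (Fin r) R) :
    traceFree (c • A) = c • traceFree A := by
  rw [traceFree, traceFree, trace_smul, smul_sub, smul_smul, smul_smul, smul_smul, smul_eq_mul,
    mul_comm c, mul_comm c]

theorem traceFree_add (A B : Matrix (Fin r) (Fin r) R) :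
    traceFree (A + B) = traceFree A + traceFree B := by
  rw [traceFree, traceFree, traceFree, trace_add, smul_add, add_smul]
  abel

theorem traceFree_one : traceFree (1 : Matrix (Fin r) (Fin r) R) = 0 := by
  rw [traceFree, trace_one, Fintype.card_fin, sub_self]

theorem traceFree_diagonal (b : Fin r → R) :
    traceFree (diagonal b) = diagonal fun i => r * b i - ∑ j, b j := by
  rw [traceFree, trace_diagonal, smul_one_eq_diagonal, ← diagonal_smul, diagonal_sub]
  rfl

end CommRing

variable {K : Type*} [Field K]

namespace Diagonalizes

variable {V A : Matrix (Fin r) (Fin r) K} {lam : Fin r → K}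

theorem pow_mul_eq (h : Diagonalizes V A lam) (j : ℕ) : A ^ j * V = V * diagonal (lam ^ j) := by
  rw [← diagonal_pow]
  exact ((show SemiconjBy V (diagonal lam) A from h.mul_eq.symm).pow_right j).symm

theorem inv_mul_pow (h : Diagonalizes V A lam) (j : ℕ) :
    V⁻¹ * A ^ j = diagonal (lam ^ j) * V⁻¹ := by
  rw [← mul_nonsing_inv_cancel_right V (V⁻¹ * A ^ j) h.isUnit_det, Matrix.mul_assoc V⁻¹,
    h.pow_mul_eq, nonsing_inv_mul_cancel_left V _ h.isUnit_det]

theorem smul_add_smul_one (h : Diagonalizes V A lam) {c : K} (hc : c ≠ 0) (e : K) :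
    Diagonalizes V (c • A + e • 1) fun b => c * lam b + e := by
  refine ⟨h.isUnit_det, fun a b hab => h.injective (mul_left_cancel₀ hc (add_right_cancel hab)), ?_⟩
  rw [Matrix.add_mul, Matrix.smul_mul, h.mul_eq, Matrix.smul_mul, Matrix.one_mul]
  ext i j
  simp only [Matrix.add_apply, Matrix.smul_apply, mul_diagonal, smul_eq_mul]
  ring

theorem smul (h : Diagonalizes V A lam) {c : K} (hc : c ≠ 0) :
    Diagonalizes V (c • A) fun b => c * lam b := by
  simpa using h.smul_add_smul_one hc 0

theorem traceFree [CharZero K] [NeZero r] (h : Diagonalizes V A lam) :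
    Diagonalizes V (traceFree A) fun b => r * lam b - A.trace := by
  simpa only [BlostrMPS.traceFree, sub_eq_add_neg, neg_smul] using
    h.smul_add_smul_one (NeZero.ne (r : K)) (-A.trace)

theorem of_traceFree [CharZero K] [NeZero r] (h : Diagonalizes V (BlostrMPS.traceFree A) lam) :
    ∃ lam', Diagonalizes V A lam' := by
  have hr : (r : K) ≠ 0 := NeZero.ne _
  have hA : A = (r : K)⁻¹ • BlostrMPS.traceFree A + ((r : K)⁻¹ * A.trace) • 1 := by
    rw [BlostrMPS.traceFree, smul_sub, smul_smul, smul_smul, inv_mul_cancel₀ hr, one_smul,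
      sub_add_cancel]
  have h' := h.smul_add_smul_one (inv_ne_zero hr) ((r : K)⁻¹ * A.trace)
  rw [← hA] at h'
  exact ⟨_, h'⟩

theorem eigenvalue_ne_zero (h : Diagonalizes V A lam) (hA : IsUnit A.det) (b : Fin r) :
    lam b ≠ 0 := by
  have hdet := congrArg det h.mul_eq
  rw [det_mul, det_mul, det_diagonal, mul_comm V.det] at hdet
  have hprod : ∏ b, lam b ≠ 0 := by
    rw [← mul_right_cancel₀ h.isUnit_det.ne_zero hdet]
    exact hA.ne_zero
  exact Finset.prod_ne_zero_iff.1 hprod b (Finset.mem_univ b)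

end Diagonalizes

open Polynomial in
theorem det_hankel_eq_zero_of_isNilpotent_aeval {A : Matrix (Fin r) (Fin r) K} {p : K[X]}
    (hp : p ≠ 0) (hdeg : p.natDegree < r) (h : IsNilpotent (aeval A p)) : (hankel A).det = 0 := by
  have htrace : ∀ i : ℕ, (A ^ i * aeval A p).trace = 0 := fun i => by
    have hcomm : Commute (A ^ i) (aeval A p) := by
      simpa using (Commute.all (X ^ i : K[X]) p).map (aeval A)
    exact (isNilpotent_trace_of_isNilpotent (hcomm.isNilpotent_mul_left h)).eq_zero
  refine exists_mulVec_eq_zero_iff.1 ⟨fun j => p.coeff j.val, fun h₀ => ?_, ?_⟩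
  · exact hp (leadingCoeff_eq_zero.1 (congrFun h₀ ⟨p.natDegree, hdeg⟩))
  · funext i
    have hi := htrace i
    rw [aeval_eq_sum_range' hdeg, Matrix.mul_sum, trace_sum, Finset.sum_range] at hi
    rw [mulVec, dotProduct, Pi.zero_apply, ← hi]
    refine Finset.sum_congr rfl fun j _ => ?_
    rw [Matrix.mul_smul, trace_smul, smul_eq_mul, ← pow_add, mul_comm]
    rfl

open Polynomial in
theorem nodup_roots_charpoly {A : Matrix (Fin r) (Fin r) K} (h : (hankel A).det ≠ 0) :
    A.charpoly.roots.Nodup := by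
  classical
  rw [Multiset.nodup_iff_count_le_one]
  intro z
  by_contra! hcount
  rw [count_roots] at hcount
  have hmonic := A.charpoly_monic
  obtain ⟨q, hq⟩ := (le_rootMultiplicity_iff hmonic.ne_zero).1 hcount.nat_succ_le
  have hfactor : A.charpoly = (X - C z) * ((X - C z) * q) := by rw [hq]; ring
  have hp : (X - C z) * q ≠ 0 := right_ne_zero_of_mul (hfactor ▸ hmonic.ne_zero)
  have hdeg : ((X - C z) * q).natDegree < r := by
    have hchar := A.charpoly_natDegree_eq_dim
    rw [hfactor, natDegree_mul (X_sub_C_ne_zero z) hp, natDegree_X_sub_C, Fintype.card_fin]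
      at hchar
    omega
  -- The square of `(X - z) q` is a multiple of the characteristic polynomial.
  refine h (det_hankel_eq_zero_of_isNilpotent_aeval hp hdeg ⟨2, ?_⟩)
  have hsq : ((X - C z) * q) ^ 2 = A.charpoly * q := by rw [hfactor]; ring
  rw [← map_pow, hsq, map_mul, aeval_self_charpoly, zero_mul]

theorem exists_diagonalizes_of_det_hankel_ne_zero [IsAlgClosed K] {A : Matrix (Fin r) (Fin r) K}
    (h : (hankel A).det ≠ 0) : ∃ V lam, Diagonalizes V A lam := by
  classical
  have hcard : A.charpoly.roots.toFinset.card = r := by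
    rw [Multiset.toFinset_card_of_nodup (nodup_roots_charpoly h),
      ← (IsAlgClosed.splits A.charpoly).natDegree_eq_card_roots, A.charpoly_natDegree_eq_dim,
      Fintype.card_fin]
  let e := (A.charpoly.roots.toFinset.equivFinOfCardEq hcard).symm
  obtain ⟨V, hV⟩ := exists_diagonalizes (Y := A) (lam := fun b => (e b : K))
    (fun a b hab => e.injective (Subtype.ext hab)) fun b => by
      have hroot := (e b).2
      rw [Multiset.mem_toFinset, Polynomial.mem_roots A.charpoly_monic.ne_zero] at hroot
      rw [Module.End.hasEigenvalue_iff_isRoot_charpoly]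
      simpa using hroot
  exact ⟨V, _, hV⟩

theorem det_hankel_smul_ne_zero {c : K} (hc : c ≠ 0) {A : Matrix (Fin r) (Fin r) K}
    (h : (hankel A).det ≠ 0) : (hankel (c • A)).det ≠ 0 := by
  have hsmul : hankel (c • A) = diagonal (fun i : Fin r => c ^ i.val) * hankel A *
      diagonal (fun i : Fin r => c ^ i.val) := by
    ext i j
    rw [mul_diagonal, diagonal_mul, hankel, hankel, of_apply, of_apply, smul_pow, trace_smul,
      smul_eq_mul, pow_add]
    ring
  have hprod : ∏ i : Fin r, c ^ i.val ≠ 0 := Finset.prod_ne_zero_iff.2 fun _ _ => pow_ne_zero _ hc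
  rw [hsmul, det_mul, det_mul, det_diagonal]
  exact mul_ne_zero (mul_ne_zero hprod h) hprod

theorem det_hankel_diagonal_ne_zero {b : Fin r → K} (hb : Function.Injective b) :
    (hankel (diagonal b)).det ≠ 0 := by
  have hfactor : hankel (diagonal b) = (vandermonde b)ᵀ * vandermonde b := by
    ext i j
    simp [hankel, Matrix.mul_apply, vandermonde_apply, diagonal_pow, trace, pow_add]
  rw [hfactor, det_mul, det_transpose]
  exact mul_ne_zero (det_vandermonde_ne_zero_iff.2 hb) (det_vandermonde_ne_zero_iff.2 hb)

theorem det_wordMatrix_smul_ne_zero {c c' : K} (hc : c ≠ 0) (hc' : c' ≠ 0)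
    {A A' : Matrix (Fin r) (Fin r) K} (h : (wordMatrix A A').det ≠ 0) :
    (wordMatrix (c • A) (c' • A')).det ≠ 0 := by
  have hsmul : wordMatrix (c • A) (c' • A') =
      diagonal (fun ji : Fin r × Fin r => c ^ ji.1.val * c' ^ ji.2.val) * wordMatrix A A' := by
    ext ji ab
    rw [diagonal_mul, wordMatrix, wordMatrix, of_apply, of_apply, smul_pow, smul_pow,
      Matrix.smul_mul, Matrix.mul_smul, smul_smul, Matrix.smul_apply, smul_eq_mul]
  rw [hsmul, det_mul, det_diagonal]
  exact mul_ne_zero (Finset.prod_ne_zero_iff.2 fun _ _ =>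
    mul_ne_zero (pow_ne_zero _ hc) (pow_ne_zero _ hc')) h

theorem inv_mul_apply_ne_zero_of_det_wordMatrix {A A' V V' : Matrix (Fin r) (Fin r) K}
    {lam lam' : Fin r → K} (h : (wordMatrix A A').det ≠ 0) (hV : Diagonalizes V A lam)
    (hV' : Diagonalizes V' A' lam') (b c : Fin r) : (V⁻¹ * V') b c ≠ 0 := by
  intro hbc
  have hword : ∀ j i : ℕ, (V⁻¹ * (A ^ j * A' ^ i) * V') b c = 0 := fun j i => by
    rw [← Matrix.mul_assoc, hV.inv_mul_pow, Matrix.mul_assoc, hV'.pow_mul_eq, Matrix.mul_assoc,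
      ← Matrix.mul_assoc V⁻¹, diagonal_mul, mul_diagonal, hbc, zero_mul, mul_zero]
  have hker : wordMatrix A A' *ᵥ (fun ab => V⁻¹ b ab.1 * V' ab.2 c) = 0 := by
    funext ji
    rw [Pi.zero_apply, ← hword ji.1 ji.2]
    simp only [mulVec, dotProduct, Fintype.sum_prod_type_right, wordMatrix, of_apply]
    generalize A ^ ji.1.val * A' ^ ji.2.val = W
    simp only [Matrix.mul_apply, Finset.sum_mul]
    exact Finset.sum_congr rfl fun _ _ => Finset.sum_congr rfl fun _ _ => by ring
  have hzero := eq_zero_of_mulVec_eq_zero h hker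
  obtain ⟨a, ha⟩ : ∃ a, V⁻¹ b a ≠ 0 := by
    by_contra! hrow
    exact (isUnit_nonsing_inv_det _ hV.isUnit_det).ne_zero (det_eq_zero_of_row_eq_zero b hrow)
  obtain ⟨a', ha'⟩ : ∃ a', V' a' c ≠ 0 := by
    by_contra! hcol
    exact hV'.isUnit_det.ne_zero (det_eq_zero_of_column_eq_zero c hcol)
  exact mul_ne_zero ha ha' (congrFun hzero (a, a'))

theorem mul_adjugate_eq_smul {X Y : Matrix (Fin r) (Fin r) K} (hY : IsUnit Y.det) :
    X * Y.adjugate = Y.det • (X * Y⁻¹) := by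
  rw [inv_def, Matrix.mul_smul, smul_smul, Ring.mul_inverse_cancel _ hY, one_smul]

end Spectrum

section Shift

variable {r : ℕ} [NeZero r]

/-- The permutation matrix of the cyclic shift, with ones at the positions `(a, a + 1)`. -/
def shiftMatrix (r : ℕ) [NeZero r] (R : Type*) [Zero R] [One R] : Matrix (Fin r) (Fin r) R :=
  of fun a c => if c = a + 1 then 1 else 0

theorem shiftMatrix_pow_apply {R : Type*} [CommRing R] (i : ℕ) (a c : Fin r) :
    (shiftMatrix r R ^ i) a c = if c = a + Fin.ofNat r i then 1 else 0 := by
  induction i generalizing a with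
  | zero => simp [one_apply, eq_comm]
  | succ i ih =>
    have hsucc : Fin.ofNat r (i + 1) = 1 + Fin.ofNat r i := by
      ext; simp [Fin.ofNat, Fin.val_add, add_comm]
    have hshift : ∀ a c, shiftMatrix r R a c = if c = a + 1 then 1 else 0 := fun _ _ => rfl
    rw [pow_succ', Matrix.mul_apply]
    simp only [ih, hshift, ite_mul, one_mul, zero_mul, Finset.sum_ite_eq',
      Finset.mem_univ, if_true, hsucc, add_assoc]

theorem traceFree_shiftMatrix {R : Type*} [CommRing R] (hr : 2 ≤ r) :
    traceFree (shiftMatrix r R) = (r : R) • shiftMatrix r R := by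
  have htrace : (shiftMatrix r R).trace = 0 := by
    refine Finset.sum_eq_zero fun i _ => ?_
    rw [diag_apply, shiftMatrix, of_apply, if_neg]
    intro h
    have hone := congrArg Fin.val (left_eq_add.1 h)
    rw [Fin.val_one', Fin.val_zero, Nat.mod_eq_of_lt (by omega)] at hone
    omega
  rw [traceFree, htrace, zero_smul, sub_zero]

theorem det_hankel_shiftMatrix_ne_zero {K : Type*} [Field K] [CharZero K] :
    (hankel (shiftMatrix r K)).det ≠ 0 := by
  have hperm : hankel (shiftMatrix r K) = (r : K) • (Equiv.neg (Fin r)).permMatrix K := by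
    ext i j
    have hindex : Fin.ofNat r (i.val + j.val) = i + j := Fin.ext (by simp [Fin.ofNat, Fin.val_add])
    simp only [hankel, of_apply, trace, diag_apply, shiftMatrix_pow_apply, hindex]
    simp [PEquiv.toMatrix_apply, neg_eq_iff_add_eq_zero]
  rw [hperm, det_smul, det_permutation]
  exact mul_ne_zero (pow_ne_zero _ (NeZero.ne _)) (Int.cast_ne_zero.2 (Units.ne_zero _))

theorem det_wordMatrix_diagonal_shiftMatrix_ne_zero {K : Type*} [Field K] {b : Fin r → K}
    (hb : Function.Injective b) : (wordMatrix (diagonal b) (shiftMatrix r K)).det ≠ 0 := by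
  intro h
  obtain ⟨ξ, hξ₀, hξ⟩ := exists_vecMul_eq_zero_iff.2 h
  have hvandermonde : ∀ i : Fin r, vandermonde b *ᵥ (fun j => ξ (j, i)) = 0 := by
    intro i
    funext a
    have hai := congrFun hξ (a, a + i)
    have hindex : ∀ k : Fin r, (a + i = a + Fin.ofNat r k.val) ↔ k = i := fun k => by
      have hk : Fin.ofNat r k.val = k := by ext; simp [Fin.ofNat, Nat.mod_eq_of_lt k.isLt]
      rw [hk, add_right_inj, eq_comm]
    simp only [vecMul, dotProduct, Fintype.sum_prod_type, wordMatrix, of_apply, diagonal_pow,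
      diagonal_mul, shiftMatrix_pow_apply, Pi.zero_apply, Pi.pow_apply, hindex, mul_ite, mul_one,
      mul_zero, Finset.sum_ite_eq', Finset.mem_univ, if_true] at hai
    rw [Pi.zero_apply, ← hai, mulVec, dotProduct]
    exact Finset.sum_congr rfl fun _ _ => by rw [vandermonde_apply, mul_comm]
  exact hξ₀ <| funext fun ji => congrFun
    (eq_zero_of_mulVec_eq_zero (det_vandermonde_ne_zero_iff.2 hb) (hvandermonde ji.2)) ji.1

end Shift

namespace AnalyticMat

variable {r : ℕ} {E : Type*} [NormedAddCommGroup E] [NormedSpace ℝ E]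
  {A A' : E → Matrix (Fin r) (Fin r) ℂ}

theorem hankel (hA : AnalyticMat A) : AnalyticMat fun x => hankel (A x) :=
  fun i j => (hA.pow (i.val + j.val)).trace

theorem wordMatrix (hA : AnalyticMat A) (hA' : AnalyticMat A') :
    AnalyticMat fun x => wordMatrix (A x) (A' x) :=
  fun ji ab => ((hA.pow ji.1.val).mul (hA'.pow ji.2.val)) ab.1 ab.2

theorem traceFree (hA : AnalyticMat A) : AnalyticMat fun x => traceFree (A x) :=
  (AnalyticMat.smul analyticOnNhd_const hA).sub (AnalyticMat.smul hA.trace (AnalyticMat.const 1))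

end AnalyticMat

section LinearAlgebra

variable {K V : Type*} [Field K] [AddCommGroup V] [Module K V]

theorem exists_dual_eq_of_linearIndependent_mkQ {κ : Type*} {p : Submodule K V} {u : κ → V}
    (hu : LinearIndependent K (p.mkQ ∘ u)) (a : κ → K) :
    ∃ S : Module.Dual K V, (∀ y ∈ p, S y = 0) ∧ ∀ i, S (u i) = a i := by
  obtain ⟨S, hS⟩ := ((Module.Basis.span hu).constr K a).exists_extend
  refine ⟨S.comp p.mkQ, fun y hy => ?_, fun i => ?_⟩
  · rw [LinearMap.comp_apply, Submodule.mkQ_apply, (Submodule.Quotient.mk_eq_zero p).2 hy, map_zero]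
  · have hi := (Module.Basis.span hu).constr_basis K a i
    rwa [← hS, LinearMap.comp_apply, Submodule.subtype_apply, Module.Basis.span_apply] at hi

theorem span_range_ne_top_of_apply_eq_zero {κ : Type*} [Fintype κ] {w : κ → V} {i : κ}
    (hi : w i = 0) (hcard : Fintype.card κ ≤ Module.finrank K V) :
    Submodule.span K (Set.range w) ≠ ⊤ := by
  intro htop
  have hrank := finrank_range_le_card (R := K) w
  rw [Set.finrank, htop, finrank_top] at hrank
  exact (linearIndependent_of_top_le_span_of_card_eq_finrank htop.ge
    (hcard.antisymm hrank)).ne_zero i hi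

theorem exists_inf_span_pair_le_span_singleton {a b c e : V} (hab : LinearIndependent K ![a, b])
    (hce : LinearIndependent K ![c, e])
    (hne : Submodule.span K {a, b} ≠ Submodule.span K {c, e}) :
    ∃ x : V, x ≠ 0 ∧ Submodule.span K {a, b} ⊓ Submodule.span K {c, e} ≤ Submodule.span K {x} := by
  have hfinrank : ∀ {y z : V}, LinearIndependent K ![y, z] →
      Module.finrank K (Submodule.span K {y, z}) = 2 := fun h => by
    have hcard := finrank_span_eq_card h
    rwa [Matrix.range_cons_cons_empty, Fintype.card_fin] at hcard
  have hfinite : ∀ y z : V, FiniteDimensional K (Submodule.span K {y, z}) := fun y z =>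
    FiniteDimensional.span_of_finite K (Set.toFinite {y, z})
  have := hfinite a b
  have := hfinite c e
  have hle : Module.finrank K ↥(Submodule.span K {a, b} ⊓ Submodule.span K {c, e}) ≤ 1 := by
    by_contra! hlt
    exact hne <|
      (Submodule.eq_of_le_of_finrank_le inf_le_left ((hfinrank hab).trans_le hlt)).symm.trans
      (Submodule.eq_of_le_of_finrank_le inf_le_right ((hfinrank hce).trans_le hlt))
  obtain ⟨x, hx⟩ := finrank_le_one_iff.1 hle
  have hspan : Submodule.span K {a, b} ⊓ Submodule.span K {c, e} ≤ Submodule.span K {(x : V)} :=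
    fun y hy => Submodule.mem_span_singleton.2 <|
      (hx ⟨y, hy⟩).imp fun _ ht => congrArg Subtype.val ht
  rcases eq_or_ne (x : V) 0 with hx₀ | hx₀
  · refine ⟨a, hab.ne_zero 0, hspan.trans ?_⟩
    rw [hx₀, Submodule.span_zero_singleton]
    exact bot_le
  · exact ⟨x, hx₀, hspan⟩

/-- The difference of the representatives of `a` and `b` on the affine hyperplane `φ = 1`. -/
def hyperplaneSub (φ : Module.Dual K V) (a b : V) : V := (φ a)⁻¹ • a - (φ b)⁻¹ • b

variable {φ : Module.Dual K V} {a b c e : V}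

theorem map_hyperplaneSub (S : Module.Dual K V) :
    S (hyperplaneSub φ a b) = S a / φ a - S b / φ b := by
  rw [hyperplaneSub, map_sub, map_smul, map_smul, smul_eq_mul, smul_eq_mul, inv_mul_eq_div,
    inv_mul_eq_div]

theorem map_hyperplaneSub_self (ha : φ a ≠ 0) (hb : φ b ≠ 0) : φ (hyperplaneSub φ a b) = 0 := by
  rw [map_hyperplaneSub, div_self ha, div_self hb, sub_self]

theorem hyperplaneSub_mem {p : Submodule K V} (ha : a ∈ p) (hb : b ∈ p) :
    hyperplaneSub φ a b ∈ p :=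
  p.sub_mem (p.smul_mem _ ha) (p.smul_mem _ hb)

theorem hyperplaneSub_ne_zero (ha : φ a ≠ 0) (hab : LinearIndependent K ![a, b]) :
    hyperplaneSub φ a b ≠ 0 := fun h =>
  inv_ne_zero ha (LinearIndependent.pair_iff.1 hab (φ a)⁻¹ (-(φ b)⁻¹) <| by
    rw [neg_smul, ← sub_eq_add_neg]; exact h).1

theorem linearIndependent_hyperplaneSub (hab : LinearIndependent K ![a, b])
    (hce : LinearIndependent K ![c, e]) (ha : φ a ≠ 0) (hb : φ b ≠ 0) (hc : φ c ≠ 0)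
    (hker : ∀ y ∈ Submodule.span K {a, b} ⊓ Submodule.span K {c, e}, φ y = 0 → y = 0) :
    LinearIndependent K ![hyperplaneSub φ a b, hyperplaneSub φ c e] := by
  refine LinearIndependent.pair_iff.2 fun α β hzero => ?_
  have hmem : ∀ y z : V, hyperplaneSub φ y z ∈ Submodule.span K {y, z} := fun y z =>
    hyperplaneSub_mem (Submodule.subset_span (by simp)) (Submodule.subset_span (by simp))
  have hα : α • hyperplaneSub φ a b = 0 := by
    refine hker _ ⟨Submodule.smul_mem _ _ (hmem a b), ?_⟩ ?_
    · rw [eq_neg_of_add_eq_zero_left hzero]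
      exact Submodule.neg_mem _ (Submodule.smul_mem _ _ (hmem c e))
    · rw [map_smul, map_hyperplaneSub_self ha hb, smul_zero]
  rw [hα, zero_add] at hzero
  exact ⟨(smul_eq_zero.1 hα).resolve_right (hyperplaneSub_ne_zero ha hab),
    (smul_eq_zero.1 hzero).resolve_right (hyperplaneSub_ne_zero hc hce)⟩

end LinearAlgebra

section Functionals

variable {ι : Type*} [Fintype ι] [DecidableEq ι] {n : ι → ℕ}

/-- The linear functional on the direct sum of the local spaces with local components `g`. -/
def pairing (g : (l : ι) → Fin (n l) → ℂ) : Module.Dual ℂ ((l : ι) → Fin (n l) → ℂ) :=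
  LinearMap.lsum ℂ (fun l => Fin (n l) → ℂ) ℂ fun l => dotProductEquiv ℂ (Fin (n l)) (g l)

theorem pairing_apply (g w : (l : ι) → Fin (n l) → ℂ) : pairing g w = ∑ l, g l ⬝ᵥ w l := by
  simp [pairing, LinearMap.lsum_apply]

theorem pairing_single (g : (l : ι) → Fin (n l) → ℂ) (h : ι) (v : Fin (n h) → ℂ) :
    pairing g (Pi.single h v) = g h ⬝ᵥ v := by
  rw [pairing, LinearMap.lsum_piSingle]
  rfl

theorem exists_eq_pairing (S : Module.Dual ℂ ((l : ι) → Fin (n l) → ℂ)) : ∃ g, S = pairing g :=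
  ⟨fun l => (dotProductEquiv ℂ (Fin (n l))).symm
    ((LinearMap.lsum ℂ (fun l => Fin (n l) → ℂ) ℂ).symm S l), by
      simp only [pairing, LinearEquiv.apply_symm_apply]⟩

open ComplexOrder in
theorem pairing_star_self_ne_zero {x : (l : ι) → Fin (n l) → ℂ} (hx : x ≠ 0) :
    pairing (star x) x ≠ 0 := by
  obtain ⟨l, hl⟩ := Function.ne_iff.1 hx
  rw [pairing_apply]
  exact (Finset.sum_pos' (fun l _ => dotProduct_star_self_nonneg (x l))
    ⟨l, Finset.mem_univ l, dotProduct_star_self_pos_iff.2 hl⟩).ne'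

theorem pairing_star_comm (x y : (l : ι) → Fin (n l) → ℂ) :
    pairing (star x) y = star (pairing (star y) x) := by
  rw [pairing_apply, pairing_apply, star_sum]
  exact Finset.sum_congr rfl fun l _ => star_dotProduct (x l) (y l)

theorem exists_pairing_star_ne_zero_notMem {κ : Type*} [Finite κ]
    {y : κ → (l : ι) → Fin (n l) → ℂ} (hy : ∀ i, y i ≠ 0)
    {U : (l : ι) → Submodule ℂ (Fin (n l) → ℂ)} (hU : ∀ l, U l ≠ ⊤) :
    ∃ x : (l : ι) → Fin (n l) → ℂ, (∀ i, pairing (star x) (y i) ≠ 0) ∧ ∀ l, x l ∉ U l := by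
  let T : κ ⊕ ι → Submodule ℂ ((l : ι) → Fin (n l) → ℂ) :=
    Sum.elim (fun i => LinearMap.ker (pairing (star (y i)))) fun l => (U l).comap (LinearMap.proj l)
  have hT : ∀ t, T t ≠ ⊤ := by
    rintro (i | l) htop
    · exact pairing_star_self_ne_zero (hy i) (LinearMap.congr_fun (LinearMap.ker_eq_top.1 htop) _)
    · refine hU l (eq_top_iff.2 fun v _ => ?_)
      have hmem : Pi.single l v ∈ T (Sum.inr l) := htop ▸ Submodule.mem_top
      simpa [T] using hmem
  obtain ⟨x, hx⟩ : ∃ x, ∀ t, x ∉ T t := by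
    by_contra! hcover
    obtain ⟨t, ht⟩ := Subspace.exists_eq_top_of_iUnion_eq_univ (k := ℂ) (p := T)
      (Set.eq_univ_of_forall fun x => Set.mem_iUnion.2 (hcover x))
    exact hT t ht
  refine ⟨x, fun i hi => hx (Sum.inl i) ?_, fun l => hx (Sum.inr l)⟩
  rwa [pairing_star_comm, star_eq_zero] at hi

theorem eq_zero_of_mem_pi_span_singleton {κ : Type*} [Nonempty κ]
    {w : κ → (l : ι) → Fin (n l) → ℂ} {h : κ → ι} {x y : (l : ι) → Fin (n l) → ℂ}
    (hx : ∀ l, x l ≠ 0)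
    (hxw : ∀ i l, h i ≠ l → x l ∉ Submodule.span ℂ (Set.range fun j => w j l))
    (hyw : y ∈ Submodule.span ℂ (Set.range w))
    (hyx : y ∈ Submodule.pi Set.univ fun l => Submodule.span ℂ {x l})
    (hy : pairing (star x) y = 0) : y = 0 := by
  choose c hc using fun l => Submodule.mem_span_singleton.1 (hyx l (Set.mem_univ l))
  have hoff : ∀ i l, h i ≠ l → y l = 0 := by
    intro i l hil
    have hmem : y l ∈ Submodule.span ℂ (Set.range fun j => w j l) := by
      have hmap : y l ∈ (Submodule.span ℂ (Set.range w)).map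
          (LinearMap.proj l : ((l : ι) → Fin (n l) → ℂ) →ₗ[ℂ] Fin (n l) → ℂ) :=
        Submodule.mem_map_of_mem hyw
      rwa [Submodule.map_span, ← Set.range_comp] at hmap
    rw [← hc l] at hmem ⊢
    by_contra hne
    exact hxw i l hil ((Submodule.smul_mem_iff _ fun h₀ => hne (by rw [h₀, zero_smul])).1 hmem)
  funext l
  by_cases hl : ∃ i, h i ≠ l
  · obtain ⟨i, hi⟩ := hl
    exact hoff i l hi
  · push Not at hl
    obtain ⟨i⟩ := ‹Nonempty κ›
    have hy' : star (x l) ⬝ᵥ y l = 0 := by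
      rw [← hy, pairing_apply]
      refine Eq.symm (Finset.sum_eq_single_of_mem l (Finset.mem_univ l) fun l' _ hl' => ?_)
      rw [hoff i l' fun h' => hl' (h'.symm.trans (hl i)), dotProduct_zero]
    rw [← hc l, dotProduct_smul, smul_eq_mul] at hy'
    have hself : star (x l) ⬝ᵥ x l ≠ 0 := by
      open ComplexOrder in exact fun h₀ => hx l (dotProduct_star_self_eq_zero.1 h₀)
    rw [← hc l, (mul_eq_zero.1 hy').resolve_right hself, zero_smul, Pi.zero_apply]

variable {h : Fin 4 → ι} {v : (i : Fin 4) → Fin (n (h i)) → ℂ}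

theorem exists_pairing_star_ne_zero_notMem_span_range (hn : ∀ l, 4 ≤ n l)
    {w : Fin 4 → (l : ι) → Fin (n l) → ℂ} (hw : ∀ i l, h i ≠ l → w i l = 0) (hw₀ : ∀ i, w i ≠ 0)
    {e : (l : ι) → Fin (n l) → ℂ} (he : e ≠ 0) :
    ∃ x : (l : ι) → Fin (n l) → ℂ, (∀ i, pairing (star x) (w i) ≠ 0) ∧
      pairing (star x) e ≠ 0 ∧ (∀ l, x l ≠ 0) ∧
      ∀ i l, h i ≠ l → x l ∉ Submodule.span ℂ (Set.range fun j => w j l) := by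
  classical
  let U : (l : ι) → Submodule ℂ (Fin (n l) → ℂ) := fun l =>
    if ∃ i, h i ≠ l then Submodule.span ℂ (Set.range fun j => w j l) else ⊥
  have hU : ∀ l, U l ≠ ⊤ := by
    intro l
    have hfinrank : Fintype.card (Fin 4) ≤ Module.finrank ℂ (Fin (n l) → ℂ) := by
      rw [Fintype.card_fin, Module.finrank_fin_fun]
      exact hn l
    by_cases hl : ∃ i, h i ≠ l
    · obtain ⟨i, hi⟩ := hl
      rw [show U l = _ from if_pos ⟨i, hi⟩]
      exact span_range_ne_top_of_apply_eq_zero (w := fun j => w j l) (hw i l hi) hfinrank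
    · have : Nonempty (Fin (n l)) := ⟨⟨0, by have := hn l; omega⟩⟩
      rw [show U l = _ from if_neg hl]
      exact bot_ne_top
  obtain ⟨x, hxy, hxU⟩ := exists_pairing_star_ne_zero_notMem
    (y := fun o : Option (Fin 4) => o.elim e w)
    (Option.forall.2 ⟨he, hw₀⟩) hU
  exact ⟨x, fun i => hxy (some i), hxy none, fun l hl => hxU l (hl ▸ Submodule.zero_mem _),
    fun i l hil => (show U l = _ from if_pos ⟨i, hil⟩) ▸ hxU l⟩

theorem exists_linearIndependent_mkQ_hyperplaneSub (hn : ∀ l, 4 ≤ n l)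
    {w : Fin 4 → (l : ι) → Fin (n l) → ℂ} (hw : ∀ i l, h i ≠ l → w i l = 0)
    (h₀₁ : LinearIndependent ℂ ![w 0, w 1]) (h₂₃ : LinearIndependent ℂ ![w 2, w 3])
    (hne : Submodule.span ℂ {w 0, w 1} ≠ Submodule.span ℂ {w 2, w 3}) :
    ∃ x : (l : ι) → Fin (n l) → ℂ, (∀ i, pairing (star x) (w i) ≠ 0) ∧ (∀ l, x l ≠ 0) ∧
      LinearIndependent ℂ ((Submodule.pi Set.univ fun l => Submodule.span ℂ {x l}).mkQ ∘
        ![hyperplaneSub (pairing (star x)) (w 0) (w 1),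
          hyperplaneSub (pairing (star x)) (w 2) (w 3)]) := by
  obtain ⟨e, he, hinf⟩ := exists_inf_span_pair_le_span_singleton h₀₁ h₂₃ hne
  have hw₀ : ∀ i, w i ≠ 0 :=
    Fin.forall_fin_succ.2 ⟨h₀₁.ne_zero 0, Fin.forall_fin_succ.2 ⟨h₀₁.ne_zero 1,
      Fin.forall_fin_two.2 ⟨h₂₃.ne_zero 0, h₂₃.ne_zero 1⟩⟩⟩
  obtain ⟨x, hxw, hxe, hx, hxU⟩ := exists_pairing_star_ne_zero_notMem_span_range hn hw hw₀ he
  refine ⟨x, hxw, hx, (linearIndependent_hyperplaneSub h₀₁ h₂₃ (hxw 0) (hxw 1) (hxw 2) ?_).map ?_⟩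
  · intro y hy hy₀
    obtain ⟨c, rfl⟩ := Submodule.mem_span_singleton.1 (hinf hy)
    rw [map_smul] at hy₀
    rw [(smul_eq_zero.1 hy₀).resolve_right hxe, zero_smul]
  · rw [Submodule.ker_mkQ, Submodule.disjoint_def]
    intro y hyu hyx
    have hsub : ∀ i, w i ∈ Submodule.span ℂ (Set.range w) := fun i =>
      Submodule.subset_span ⟨i, rfl⟩
    have hspan : Submodule.span ℂ (Set.range ![hyperplaneSub (pairing (star x)) (w 0) (w 1),
        hyperplaneSub (pairing (star x)) (w 2) (w 3)]) ≤
        Submodule.span ℂ (Set.range w) ⊓ LinearMap.ker (pairing (star x)) := by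
      rw [Submodule.span_le, Matrix.range_cons_cons_empty, Set.pair_subset_iff]
      exact ⟨⟨hyperplaneSub_mem (hsub 0) (hsub 1), map_hyperplaneSub_self (hxw 0) (hxw 1)⟩,
        hyperplaneSub_mem (hsub 2) (hsub 3), map_hyperplaneSub_self (hxw 2) (hxw 3)⟩
    exact eq_zero_of_mem_pi_span_singleton hx hxU (hspan hyu).1 hyx (hspan hyu).2

omit [Fintype ι] in
theorem exists_separating_functionals [Finite ι] (hn : ∀ l, 4 ≤ n l)
    (h₀₁ : LinearIndependent ℂ ![(Pi.single (h 0) (v 0) : (l : ι) → Fin (n l) → ℂ),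
      Pi.single (h 1) (v 1)])
    (h₂₃ : LinearIndependent ℂ ![(Pi.single (h 2) (v 2) : (l : ι) → Fin (n l) → ℂ),
      Pi.single (h 3) (v 3)])
    (hne : Submodule.span ℂ {(Pi.single (h 0) (v 0) : (l : ι) → Fin (n l) → ℂ),
      Pi.single (h 1) (v 1)} ≠ Submodule.span ℂ {(Pi.single (h 2) (v 2) :
        (l : ι) → Fin (n l) → ℂ), Pi.single (h 3) (v 3)}) :
    ∃ f : (l : ι) → Fin (n l) → ℂ, (∀ i, f (h i) ⬝ᵥ v i ≠ 0) ∧ (∀ l, f l ≠ 0) ∧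
      ∀ a b : ℂ, ∃ g : (l : ι) → Fin (n l) → ℂ, (∀ l, g l ⬝ᵥ star (f l) = 0) ∧
        g (h 0) ⬝ᵥ v 0 / f (h 0) ⬝ᵥ v 0 - g (h 1) ⬝ᵥ v 1 / f (h 1) ⬝ᵥ v 1 = a ∧
        g (h 2) ⬝ᵥ v 2 / f (h 2) ⬝ᵥ v 2 - g (h 3) ⬝ᵥ v 3 / f (h 3) ⬝ᵥ v 3 = b := by
  cases nonempty_fintype ι
  obtain ⟨x, hxw, hx, hli⟩ := exists_linearIndependent_mkQ_hyperplaneSub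
    (w := fun i => Pi.single (h i) (v i)) hn (fun i l hil => Pi.single_eq_of_ne' hil _) h₀₁ h₂₃ hne
  refine ⟨star x, fun i => by simpa only [pairing_single] using hxw i,
    fun l => star_ne_zero.2 (hx l), fun a b => ?_⟩
  obtain ⟨S, hS, hSu⟩ := exists_dual_eq_of_linearIndependent_mkQ hli ![a, b]
  obtain ⟨g, rfl⟩ := exists_eq_pairing S
  refine ⟨g, fun l => ?_, ?_, ?_⟩
  · rw [Pi.star_apply, star_star, ← pairing_single]
    refine hS _ fun l' _ => ?_
    rcases eq_or_ne l' l with rfl | hl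
    · rw [Pi.single_eq_same]
      exact Submodule.mem_span_singleton_self _
    · rw [Pi.single_eq_of_ne hl]
      exact Submodule.zero_mem _
  · simpa [map_hyperplaneSub, pairing_single] using hSu 0
  · simpa [map_hyperplaneSub, pairing_single] using hSu 1

end Functionals

section FirstOrder

/-- Every value of `R` is `R 0` plus `ε` times a continuous function of `ε`. Unlike
differentiability, this needs no norm, so it applies to matrices directly. -/
def HasContinuousSlope {M : Type*} [AddCommMonoid M] [Module ℂ M] [TopologicalSpace M]
    (R : ℂ → M) : Prop :=
  ∃ Y : ℂ → M, Continuous Y ∧ ∀ ε, R ε = R 0 + ε • Y ε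

namespace HasContinuousSlope

section Module

variable {M : Type*} [AddCommMonoid M] [Module ℂ M] [TopologicalSpace M]

theorem add_smul (a b : M) : HasContinuousSlope fun ε : ℂ => a + ε • b :=
  ⟨fun _ => b, continuous_const, fun ε => by dsimp only; rw [zero_smul, add_zero]⟩

theorem const_smul [ContinuousConstSMul ℂ M] {R : ℂ → M} (h : HasContinuousSlope R) (c : ℂ) :
    HasContinuousSlope fun ε => c • R ε := by
  obtain ⟨Y, hY, hR⟩ := h
  refine ⟨fun ε => c • Y ε, hY.const_smul c, fun ε => ?_⟩
  dsimp only
  rw [hR ε, smul_add, smul_comm]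

theorem sum [ContinuousAdd M] {ι : Type*} [Fintype ι] {R : ι → ℂ → M}
    (h : ∀ i, HasContinuousSlope (R i)) : HasContinuousSlope fun ε => ∑ i, R i ε := by
  choose Y hY hR using h
  refine ⟨fun ε => ∑ i, Y i ε, continuous_finsetSum _ fun i _ => hY i, fun ε => ?_⟩
  rw [Finset.smul_sum, ← Finset.sum_add_distrib]
  exact Finset.sum_congr rfl fun i _ => hR i ε

end Module

variable {A : Type*} [Semiring A] [Algebra ℂ A] [TopologicalSpace A] [IsTopologicalSemiring A]
  [ContinuousSMul ℂ A]

theorem mul {R R' : ℂ → A} (h : HasContinuousSlope R) (h' : HasContinuousSlope R') :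
    HasContinuousSlope fun ε => R ε * R' ε := by
  obtain ⟨Y, hY, hR⟩ := h
  obtain ⟨Y', hY', hR'⟩ := h'
  refine ⟨fun ε => R 0 * Y' ε + Y ε * R' 0 + ε • (Y ε * Y' ε), by fun_prop, fun ε => ?_⟩
  dsimp only
  rw [hR ε, hR' ε]
  simp only [add_mul, mul_add, smul_mul_assoc, mul_smul_comm, smul_add]
  abel

theorem list_prod {ι : Type*} {R : ι → ℂ → A} (L : List ι)
    (h : ∀ i ∈ L, HasContinuousSlope (R i)) :
    HasContinuousSlope fun ε => (L.map fun i => R i ε).prod := by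
  induction L with
  | nil => simpa using add_smul (1 : A) 0
  | cons i L ih =>
    simp only [List.map_cons, List.prod_cons]
    exact (h i List.mem_cons_self).mul (ih fun j hj => h j (List.mem_cons_of_mem i hj))

end HasContinuousSlope

variable {r : ℕ}

/-- Up to a scalar function of `ε` which does not vanish at `0`, `R ε` is `1 + ε • X` to first
order at `ε = 0`. -/
def IsScalarPerturbation (R : ℂ → Matrix (Fin r) (Fin r) ℂ) (X : Matrix (Fin r) (Fin r) ℂ) :
    Prop :=
  ∃ (x : ℂ → ℂ) (Y : ℂ → Matrix (Fin r) (Fin r) ℂ), Continuous x ∧ Continuous Y ∧ x 0 ≠ 0 ∧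
    Y 0 = x 0 • X ∧ ∀ ε, R ε = x ε • (1 : Matrix (Fin r) (Fin r) ℂ) + ε • Y ε

theorem smul_traceFree_mul_adjugate {R : Type*} [CommRing R] {A A' Y Y' : Matrix (Fin r) (Fin r) R}
    {x x' ε : R} (hA : A = x • (1 : Matrix (Fin r) (Fin r) R) + ε • Y)
    (hA' : A' = x' • (1 : Matrix (Fin r) (Fin r) R) + ε • Y') :
    x' • traceFree (A * A'.adjugate) =
      ε • traceFree (A'.det • Y - A * A'.adjugate * Y') := by
  have hcancel : A * A'.adjugate * (x' • 1 + ε • Y') = A'.det • (x • 1 + ε • Y) := by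
    rw [← hA, ← hA', Matrix.mul_assoc, adjugate_mul, Matrix.mul_smul, Matrix.mul_one]
  have hexpand : x' • (A * A'.adjugate) =
      (A'.det * x) • (1 : Matrix (Fin r) (Fin r) R) +
        ε • (A'.det • Y - A * A'.adjugate * Y') := by
    rw [Matrix.mul_add, Matrix.mul_smul, Matrix.mul_smul, Matrix.mul_one] at hcancel
    rw [eq_sub_of_add_eq hcancel]
    module
  rw [← traceFree_smul, hexpand, traceFree_add, traceFree_smul, traceFree_one, smul_zero, zero_add,
    traceFree_smul]

namespace IsScalarPerturbation

variable {R R' : ℂ → Matrix (Fin r) (Fin r) ℂ} {X X' : Matrix (Fin r) (Fin r) ℂ}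

theorem det_zero_ne_zero (h : IsScalarPerturbation R X) : (R 0).det ≠ 0 := by
  obtain ⟨x, Y, -, -, hx₀, -, hR⟩ := h
  rw [hR, zero_smul, add_zero, det_smul, det_one, mul_one]
  exact pow_ne_zero _ hx₀

theorem continuous (h : IsScalarPerturbation R X) : Continuous R := by
  obtain ⟨x, Y, hx, hY, -, -, hR⟩ := h
  rw [funext hR]
  fun_prop

open Filter Topology in
theorem traceFree_mul_adjugate (h : IsScalarPerturbation R X) (h' : IsScalarPerturbation R' X') :
    ∃ Z : ℂ → Matrix (Fin r) (Fin r) ℂ, Continuous Z ∧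
      (∃ κ : ℂ, κ ≠ 0 ∧ Z 0 = κ • traceFree (X - X')) ∧
      ∀ᶠ ε in 𝓝[≠] (0 : ℂ), ∃ c : ℂ, c ≠ 0 ∧ traceFree (R ε * (R' ε).adjugate) = c • Z ε := by
  have hRc := h.continuous
  have hRc' := h'.continuous
  have hdet := h'.det_zero_ne_zero
  obtain ⟨x, Y, -, hY, hx₀, hY₀, hR⟩ := h
  obtain ⟨x', Y', hx', hY', hx₀', hY₀', hR'⟩ := h'
  refine ⟨fun ε => traceFree ((R' ε).det • Y ε - R ε * (R' ε).adjugate * Y' ε), ?_,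
    ⟨(R' 0).det * x 0, mul_ne_zero hdet hx₀, ?_⟩, ?_⟩
  · unfold traceFree
    fun_prop
  · have hadj : (R' 0).adjugate * (x' 0 • X') = (R' 0).det • X' := by
      have hzero : R' 0 = x' 0 • (1 : Matrix (Fin r) (Fin r) ℂ) := by
        rw [hR', zero_smul, add_zero]
      rw [← Matrix.one_mul X', ← Matrix.smul_mul, ← hzero, ← Matrix.mul_assoc, adjugate_mul,
        Matrix.smul_mul]
    have hzero : R 0 = x 0 • (1 : Matrix (Fin r) (Fin r) ℂ) := by rw [hR, zero_smul, add_zero]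
    dsimp only
    rw [hY₀, hY₀', Matrix.mul_assoc, hadj, hzero, ← traceFree_smul, Matrix.smul_mul, Matrix.one_mul]
    congr 1
    module
  · filter_upwards [(hx'.continuousAt.eventually_ne hx₀').filter_mono nhdsWithin_le_nhds,
      self_mem_nhdsWithin] with ε hx'ε hε
    refine ⟨(x' ε)⁻¹ * ε, mul_ne_zero (inv_ne_zero hx'ε) hε, ?_⟩
    rw [mul_smul, ← smul_traceFree_mul_adjugate (hR ε) (hR' ε), smul_smul, inv_mul_cancel₀ hx'ε,
      one_smul]

open Filter Topology in
theorem eventually_det_ne_zero (h : IsScalarPerturbation R X) :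
    ∀ᶠ ε in 𝓝[≠] (0 : ℂ), (R ε).det ≠ 0 :=
  (h.continuous.matrix_det.continuousAt.eventually_ne h.det_zero_ne_zero).filter_mono
    nhdsWithin_le_nhds

open Filter Topology in
theorem eventually_det_hankel_ne_zero (h : IsScalarPerturbation R X)
    (h' : IsScalarPerturbation R' X') (hX : (hankel (traceFree (X - X'))).det ≠ 0) :
    ∀ᶠ ε in 𝓝[≠] (0 : ℂ), (hankel (traceFree (R ε * (R' ε).adjugate))).det ≠ 0 := by
  obtain ⟨Z, hZ, ⟨κ, hκ, hZ₀⟩, hR⟩ := h.traceFree_mul_adjugate h'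
  have hcont : Continuous fun ε => (hankel (Z ε)).det :=
    (continuous_matrix fun (i j : Fin r) => (hZ.pow (i.val + j.val)).matrix_trace).matrix_det
  have hzero : (hankel (Z 0)).det ≠ 0 := by
    rw [hZ₀]
    exact det_hankel_smul_ne_zero hκ hX
  filter_upwards [(hcont.continuousAt.eventually_ne hzero).filter_mono nhdsWithin_le_nhds, hR]
    with ε hε ⟨c, hc, hRε⟩
  rw [hRε]
  exact det_hankel_smul_ne_zero hc hε

open Filter Topology in
theorem eventually_det_wordMatrix_ne_zero {S S' : ℂ → Matrix (Fin r) (Fin r) ℂ}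
    {Y Y' : Matrix (Fin r) (Fin r) ℂ} (h : IsScalarPerturbation R X)
    (h' : IsScalarPerturbation R' X') (hS : IsScalarPerturbation S Y)
    (hS' : IsScalarPerturbation S' Y')
    (hXY : (wordMatrix (traceFree (X - X')) (traceFree (Y - Y'))).det ≠ 0) :
    ∀ᶠ ε in 𝓝[≠] (0 : ℂ), (wordMatrix (traceFree (R ε * (R' ε).adjugate))
      (traceFree (S ε * (S' ε).adjugate))).det ≠ 0 := by
  obtain ⟨Z, hZ, ⟨κ, hκ, hZ₀⟩, hR⟩ := h.traceFree_mul_adjugate h'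
  obtain ⟨W, hW, ⟨κ', hκ', hW₀⟩, hS⟩ := hS.traceFree_mul_adjugate hS'
  have hcont : Continuous fun ε => (wordMatrix (Z ε) (W ε)).det :=
    (continuous_matrix fun (ji ab : Fin r × Fin r) =>
      ((hZ.pow ji.1.val).matrix_mul (hW.pow ji.2.val)).matrix_elem ab.1 ab.2).matrix_det
  have hzero : (wordMatrix (Z 0) (W 0)).det ≠ 0 := by
    rw [hZ₀, hW₀]
    exact det_wordMatrix_smul_ne_zero hκ hκ' hXY
  filter_upwards [(hcont.continuousAt.eventually_ne hzero).filter_mono nhdsWithin_le_nhds, hR, hS]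
    with ε hε ⟨c, hc, hRε⟩ ⟨c', hc', hSε⟩
  rw [hRε, hSε]
  exact det_wordMatrix_smul_ne_zero hc hc' hε

end IsScalarPerturbation

theorem isScalarPerturbation_sum_conj_trace_smul [NeZero r] {ι : Type*} [Fintype ι]
    {R : ι → ℂ → Matrix (Fin r) (Fin r) ℂ} {P : ι → ℂ} {N : ℂ} {X : Matrix (Fin r) (Fin r) ℂ}
    (hR : ∀ i, HasContinuousSlope (R i)) (hzero : ∀ i, R i 0 = P i • 1) (hN : N ≠ 0)
    (hsum : ∀ ε, ∑ i, conj (P i) • R i ε = N • (1 + ε • X)) :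
    IsScalarPerturbation (fun ε => ∑ i, conj (R i ε).trace • R i ε) X := by
  choose Y hY hRY using hR
  have hslope : ∀ i ε, R i ε = P i • (1 : Matrix (Fin r) (Fin r) ℂ) + ε • Y i ε := fun i ε => by
    rw [hRY i ε, hzero]
  refine ⟨fun ε => r * N + conj ε * ∑ i, conj (Y i ε).trace * P i,
    fun ε => (r * N) • X + conj ε • ∑ i, conj (Y i ε).trace • Y i ε, by fun_prop, by fun_prop,
    ?_, ?_, fun ε => ?_⟩
  · simpa using ⟨NeZero.ne r, hN⟩
  · simp
  · have htrace : ∀ i, conj (R i ε).trace = r * conj (P i) + conj ε * conj (Y i ε).trace :=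
      fun i => by simp [hslope i ε, mul_comm]
    calc ∑ i, conj (R i ε).trace • R i ε
        = (r : ℂ) • ∑ i, conj (P i) • R i ε +
            conj ε • ∑ i, conj (Y i ε).trace • R i ε := by
          simp only [htrace, add_smul, mul_smul, Finset.sum_add_distrib, Finset.smul_sum]
      _ = (r : ℂ) • N • (1 + ε • X) + conj ε • ((∑ i, conj (Y i ε).trace * P i) •
            (1 : Matrix (Fin r) (Fin r) ℂ) + ε • ∑ i, conj (Y i ε).trace • Y i ε) := by
          rw [hsum]
          simp only [hslope _ ε, smul_add, Finset.sum_add_distrib, Finset.sum_smul, mul_smul,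
            Finset.smul_sum, smul_comm ε]
      _ = _ := by module

end FirstOrder

section Witness

variable {d : ℕ} [NeZero d] {n : Fin d → ℕ} {r : ℕ}

/-- The product in cyclic order of `X` at the site `h` and of given factors at the sites off
`h`, `k - 1` and `k`, as a multilinear map in these factors. -/
noncomputable def envProd {A : Type*} [Semiring A] [Algebra ℂ A] (k h : Fin d) (X : A) :
    MultilinearMap ℂ (fun _ : {l : Fin d // l ∉ ({h, k - 1, k} : Finset (Fin d))} => A) A :=
  ((MultilinearMap.mkPiAlgebraFin ℂ d A).domDomCongr (Equiv.addRight (k - 1))).domDomRestrict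
    (fun l => l ∉ ({h, k - 1, k} : Finset (Fin d))) fun l => if l.1 = h then X else 1

theorem ne_of_notMem_triple {k h : Fin d}
    (l : {l : Fin d // l ∉ ({h, k - 1, k} : Finset (Fin d))}) : l.1 ≠ k - 1 ∧ l.1 ≠ k := by
  have hl := l.2
  simp only [Finset.mem_insert, Finset.mem_singleton, not_or] at hl
  exact hl.2

theorem cyclicSites_eq_ofFn (k : Fin d) : cyclicSites k = List.ofFn fun i => i + (k - 1) := by
  refine List.ext_getElem (by simp [cyclicSites]) fun i h₁ h₂ => ?_
  ext
  simp [cyclicSites, List.getElem_rotate, Fin.val_add]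

section

variable {A : Type*} [Semiring A] [Algebra ℂ A]

theorem envProd_apply (k h : Fin d) (X : A)
    (m : {l : Fin d // l ∉ ({h, k - 1, k} : Finset (Fin d))} → A) :
    envProd k h X m = ((cyclicSites k).map fun l =>
      if hl : l ∉ ({h, k - 1, k} : Finset (Fin d)) then m ⟨l, hl⟩ else
        if l = h then X else 1).prod := by
  rw [cyclicSites_eq_ofFn, List.map_ofFn]
  rfl

theorem envProd_one (k h : Fin d) (X : A) : envProd k h X (fun _ => 1) = X := by
  have hone : ∀ l, (if _ : l ∉ ({h, k - 1, k} : Finset (Fin d)) then (1 : A) else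
      if l = h then X else 1) = if l = h then X else 1 := fun l => by
    by_cases hl : l = h <;> simp [hl]
  rw [envProd_apply]
  simp only [hone]
  rw [List.prod_map_eq_pow_single h _ fun l hl _ => if_neg hl, if_pos rfl,
    List.count_eq_one_of_mem (nodup_cyclicSites k) (List.mem_rotate.2 (List.mem_finRange h)),
    pow_one]

theorem envProd_smul_one (k h : Fin d) (X : A)
    (c : {l : Fin d // l ∉ ({h, k - 1, k} : Finset (Fin d))} → ℂ) :
    envProd k h X (fun l => c l • 1) = (∏ l, c l) • X := by
  rw [MultilinearMap.map_smul_univ, envProd_one]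

end

variable [∀ k, NeZero (n k)]

theorem restProd_probeIdx (hd : 2 ≤ d) (Q : Cores n r) {k h : Fin d} (h₁ : h ≠ k - 1)
    (h₂ : h ≠ k) (c : EnvIdx n k h) (s : Fin (n h)) :
    restProd Q k (probeIdx k h c s) = envProd k h (slice Q h s) fun l => slice Q l (c l) := by
  rw [envProd_apply, cyclicSites_eq_cons_cons hd, List.map_cons, List.map_cons, List.prod_cons,
    List.prod_cons, dif_neg (by simp), if_neg h₁.symm, one_mul, dif_neg (by simp),
    if_neg h₂.symm, one_mul, restProd]
  refine congrArg List.prod (List.map_congr_left fun l hl => ?_)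
  obtain ⟨hl₁, hl₂⟩ := ne_of_mem_restSites hd hl
  by_cases hlh : l = h
  · subst hlh
    simp [probeIdx, glue, idx3]
  · simp [probeIdx, glue, hlh, hl₁, hl₂]

/-- Identity slices at `k - 1` and `k`, and slices close to scalar matrices elsewhere. At `ε = 0`
the tensor is a product of local functionals. -/
noncomputable def nearProduct (k : Fin d) (f : (l : Fin d) → Fin (n l) → ℂ)
    (D : (l : Fin d) → Fin (n l) → Matrix (Fin r) (Fin r) ℂ) (ε : ℂ) : Cores n r :=
  fun l s => if l = k - 1 ∨ l = k then (1 : Matrix (Fin r) (Fin r) ℂ) else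
    f l s • (1 : Matrix (Fin r) (Fin r) ℂ) + ε • D l s

variable {k h : Fin d} {f : (l : Fin d) → Fin (n l) → ℂ}
  {D : (l : Fin d) → Fin (n l) → Matrix (Fin r) (Fin r) ℂ}

omit [∀ k, NeZero (n k)] in
theorem slice_nearProduct_of_ne {l : Fin d} (h₁ : l ≠ k - 1) (h₂ : l ≠ k) (ε : ℂ)
    (s : Fin (n l)) : slice (nearProduct k f D ε) l s =
      f l s • (1 : Matrix (Fin r) (Fin r) ℂ) + ε • D l s :=
  if_neg (not_or_intro h₁ h₂)

omit [∀ k, NeZero (n k)] in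
theorem slice_nearProduct_of_eq {l : Fin d} (h : l = k - 1 ∨ l = k) (ε : ℂ) (s : Fin (n l)) :
    slice (nearProduct k f D ε) l s = 1 :=
  if_pos h

theorem hasContinuousSlope_probeProd_nearProduct (hd : 2 ≤ d) (v : Fin (n h) → ℂ)
    (c : EnvIdx n k h) :
    HasContinuousSlope fun ε => probeProd (nearProduct k f D ε) k h v c := by
  refine HasContinuousSlope.sum fun s => HasContinuousSlope.const_smul ?_ (v s)
  refine HasContinuousSlope.list_prod (restSites k) fun l hl => ?_
  obtain ⟨h₁, h₂⟩ := ne_of_mem_restSites hd hl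
  simp only [slice_nearProduct_of_ne h₁ h₂]
  exact HasContinuousSlope.add_smul _ _

theorem probeProd_nearProduct_zero (hd : 2 ≤ d) (h₁ : h ≠ k - 1) (h₂ : h ≠ k) (v : Fin (n h) → ℂ)
    (c : EnvIdx n k h) :
    probeProd (nearProduct k f D 0) k h v c =
      (f h ⬝ᵥ v * ∏ l, f l.1 (c l)) • (1 : Matrix (Fin r) (Fin r) ℂ) := by
  have hoff : ∀ l : {l : Fin d // l ∉ ({h, k - 1, k} : Finset (Fin d))},
      slice (nearProduct k f D 0) l (c l) = f l.1 (c l) • (1 : Matrix (Fin r) (Fin r) ℂ) :=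
    fun l => by
      obtain ⟨hl₁, hl₂⟩ := ne_of_notMem_triple l
      rw [slice_nearProduct_of_ne hl₁ hl₂, zero_smul, add_zero]
  simp only [probeProd, restProd_probeIdx hd _ h₁ h₂, hoff, envProd_smul_one,
    slice_nearProduct_of_ne h₁ h₂, zero_smul, add_zero]
  rw [mul_smul, dotProduct, Finset.sum_smul]
  exact Finset.sum_congr rfl fun s _ => by module

/-- Orthogonality at every site other than `h` makes the perturbations at these sites cancel, to
all orders in `ε`. -/
theorem sum_conj_smul_probeProd_nearProduct (hd : 2 ≤ d) (h₁ : h ≠ k - 1) (h₂ : h ≠ k)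
    (hfD : ∀ l, ∑ s, conj (f l s) • D l s = 0) (v : Fin (n h) → ℂ) (ε : ℂ) :
    ∑ c : EnvIdx n k h, conj (∏ l, f l.1 (c l)) • probeProd (nearProduct k f D ε) k h v c =
      (∏ l : {l : Fin d // l ∉ ({h, k - 1, k} : Finset (Fin d))}, star (f l) ⬝ᵥ f l) •
        ((f h ⬝ᵥ v) • (1 : Matrix (Fin r) (Fin r) ℂ) + ε • ∑ s, v s • D h s) := by
  have hlocal : ∀ l : {l : Fin d // l ∉ ({h, k - 1, k} : Finset (Fin d))},
      ∑ t, conj (f l t) • slice (nearProduct k f D ε) l t =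
        (star (f l) ⬝ᵥ f l) • (1 : Matrix (Fin r) (Fin r) ℂ) := fun l => by
    obtain ⟨hl₁, hl₂⟩ := ne_of_notMem_triple l
    simp only [slice_nearProduct_of_ne hl₁ hl₂, smul_add, smul_smul,
      Finset.sum_add_distrib, ← Finset.sum_smul]
    simp only [mul_smul, smul_comm _ ε, ← Finset.smul_sum, hfD, smul_zero, add_zero]
    rfl
  have hprod : ∀ s, ∑ c : EnvIdx n k h,
      conj (∏ l, f l.1 (c l)) • restProd (nearProduct k f D ε) k (probeIdx k h c s) =
        (∏ l : {l : Fin d // l ∉ ({h, k - 1, k} : Finset (Fin d))}, star (f l) ⬝ᵥ f l) •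
          (f h s • (1 : Matrix (Fin r) (Fin r) ℂ) + ε • D h s) := fun s => by
    simp only [restProd_probeIdx hd _ h₁ h₂, map_prod, ← MultilinearMap.map_smul_univ]
    rw [← MultilinearMap.map_sum (envProd k h (slice (nearProduct k f D ε) h s))
      fun l t => conj (f l.1 t) • slice (nearProduct k f D ε) l t]
    simp only [hlocal, envProd_smul_one, slice_nearProduct_of_ne h₁ h₂]
  simp only [probeProd, Finset.smul_sum]
  rw [Finset.sum_comm]
  simp only [smul_comm _ (v _), ← Finset.smul_sum, hprod]
  simp only [smul_comm (v _) (∏ _, _), ← Finset.smul_sum]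
  congr 1
  simp only [smul_add, Finset.sum_add_distrib, dotProduct, Finset.sum_smul]
  congr 1
  exact Finset.sum_congr rfl fun s _ => by module

open scoped ComplexOrder in
theorem isScalarPerturbation_probeCore_nearProduct [NeZero r] (hd : 2 ≤ d) (h₁ : h ≠ k - 1)
    (h₂ : h ≠ k) (hf : ∀ l, f l ≠ 0) (hfD : ∀ l, ∑ s, conj (f l s) • D l s = 0)
    {v : Fin (n h) → ℂ} (hv : f h ⬝ᵥ v ≠ 0) :
    IsScalarPerturbation (fun ε => probeCore (nearProduct k f D ε) k h v)
      ((f h ⬝ᵥ v)⁻¹ • ∑ s, v s • D h s) := by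
  have hnorm : ∏ l : {l : Fin d // l ∉ ({h, k - 1, k} : Finset (Fin d))}, star (f l) ⬝ᵥ f l ≠ 0 :=
    Finset.prod_ne_zero_iff.2 fun l _ => dotProduct_star_self_eq_zero.not.2 (hf l)
  simp only [probeCore, slice_nearProduct_of_eq (Or.inl rfl), slice_nearProduct_of_eq (Or.inr rfl),
    Matrix.one_mul]
  refine isScalarPerturbation_sum_conj_trace_smul
    (fun c => hasContinuousSlope_probeProd_nearProduct hd v c)
    (probeProd_nearProduct_zero hd h₁ h₂ v)
    (mul_ne_zero (mul_ne_zero ((map_ne_zero conj).2 hv) hnorm) hv) fun ε => ?_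
  simp only [map_mul, mul_smul, ← Finset.smul_sum]
  rw [sum_conj_smul_probeProd_nearProduct hd h₁ h₂ hfD, smul_add (f h ⬝ᵥ v),
    smul_comm (f h ⬝ᵥ v) ε, smul_inv_smul₀ hv]

end Witness

section Generic

variable {d : ℕ} [NeZero d] {n : Fin d → ℕ} [∀ k, NeZero (n k)] {r : ℕ}

omit [∀ k, NeZero (n k)] in
theorem Probes.Admissible.two_le {p : Probes n} (hp : p.Admissible) : 2 ≤ d := by
  by_contra hd
  have : Subsingleton (Fin d) := Fin.subsingleton_iff_le_one.2 (by omega)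
  exact hp.ne_right 0 0 (Subsingleton.elim _ _)

/-- The small matrix that the `i`-th probe of the pair `(k - 1, k)` extracts from the cores; up to
a scalar, the probe matrix is its image under the unfoldings of the two cores. -/
noncomputable def Probes.core (p : Probes n) (Q : Cores n r) (k : Fin d) (i : Fin 4) :
    Matrix (Fin r) (Fin r) ℂ :=
  probeCore Q k (p.site k i) (p.vec k i)

/-- The quotient of two small matrices; its eigenvalues and eigenvectors are what the algorithm
reads off a product `M^{h,v} (M^{h',v'})†`. -/
noncomputable def Probes.quotient (p : Probes n) (Q : Cores n r) (k : Fin d) (i j : Fin 4) :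
    Matrix (Fin r) (Fin r) ℂ :=
  p.core Q k i * (p.core Q k j)⁻¹

/-- The trace-free part of the quotient of two small matrices. The adjugate replaces the inverse
to keep it polynomial in the cores and their conjugates. -/
noncomputable def Probes.tracelessQuotient (p : Probes n) (Q : Cores n r) (k : Fin d)
    (i j : Fin 4) : Matrix (Fin r) (Fin r) ℂ :=
  traceFree (p.core Q k i * (p.core Q k j).adjugate)

/-- The open conditions on the cores under which the algorithm works: full column rank of the
unfoldings, invertible small matrices, simple spectra of the quotients, and eigenvectors of the two
quotients of a pair of sites in general position. -/
structure Generic (p : Probes n) (Q : Cores n r) : Prop where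
  unfold : ∀ k, ((unfoldOne Q k)ᴴ * unfoldOne Q k).det ≠ 0
  core : ∀ k i, (p.core Q k i).det ≠ 0
  hankel_fst : ∀ k, (hankel (p.tracelessQuotient Q k 0 1)).det ≠ 0
  hankel_snd : ∀ k, (hankel (p.tracelessQuotient Q k 2 3)).det ≠ 0
  word : ∀ k,
    (wordMatrix (p.tracelessQuotient Q k 0 1) (p.tracelessQuotient Q k 2 3)).det ≠ 0

omit [NeZero d] [∀ k, NeZero (n k)] in
theorem exists_det_unfoldOne_ne_zero {k : Fin d} (hn : r ^ 2 ≤ n k) :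
    ∃ Q : Cores n r, ((unfoldOne Q k)ᴴ * unfoldOne Q k).det ≠ 0 := by
  obtain ⟨e⟩ := Function.Embedding.nonempty_of_card_le
    (show Fintype.card (Fin r × Fin r) ≤ Fintype.card (Fin (n k)) by simpa [pow_two] using hn)
  let Q : Cores n r := fun l α a b => if α.val = (e (a, b)).val then 1 else 0
  have hcolumn : unfoldOne Q k = (1 : Matrix (Fin (n k)) (Fin (n k)) ℂ).submatrix id e := by
    ext α ab
    simp [unfoldOne, Q, one_apply, Fin.ext_iff]
  have hone : (unfoldOne Q k)ᴴ * unfoldOne Q k = 1 := by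
    rw [hcolumn, conjTranspose_submatrix, conjTranspose_one,
      ← submatrix_mul _ _ e id e Function.bijective_id, Matrix.one_mul,
      submatrix_one _ e.injective]
  exact ⟨Q, by rw [hone, det_one]; exact one_ne_zero⟩

theorem exists_isScalarPerturbation_core [NeZero r] (hn : ∀ k, 4 ≤ n k) {p : Probes n}
    (hp : p.Admissible) (k : Fin d) (B C : Matrix (Fin r) (Fin r) ℂ) :
    ∃ (Q : ℂ → Cores n r) (X : Fin 4 → Matrix (Fin r) (Fin r) ℂ),
      (∀ i, IsScalarPerturbation (fun ε => p.core (Q ε) k i) (X i)) ∧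
        X 0 - X 1 = B ∧ X 2 - X 3 = C := by
  obtain ⟨f, hfv, hf, hsep⟩ := exists_separating_functionals (h := p.site k) (v := p.vec k) hn
    (hp.first k) (hp.second k) (hp.pairs k)
  obtain ⟨g, hg, hg₀₁, hg₂₃⟩ := hsep 1 0
  obtain ⟨g', hg', hg'₀₁, hg'₂₃⟩ := hsep 0 1
  let D (l : Fin d) (s : Fin (n l)) : Matrix (Fin r) (Fin r) ℂ := g l s • B + g' l s • C
  have hsum : ∀ (l : Fin d) (w : Fin (n l) → ℂ),
      ∑ s, w s • D l s = (g l ⬝ᵥ w) • B + (g' l ⬝ᵥ w) • C := fun l w => by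
    simp only [D, smul_add, Finset.sum_add_distrib, smul_smul, ← Finset.sum_smul, dotProduct,
      mul_comm]
  refine ⟨nearProduct k f D, _, fun i => isScalarPerturbation_probeCore_nearProduct hp.two_le
    (hp.ne_left k i) (hp.ne_right k i) hf (fun l => ?_) (hfv i), ?_, ?_⟩
  · rw [show ∑ s, conj (f l s) • D l s = _ from hsum l (star (f l)), hg, hg', zero_smul, zero_smul,
      add_zero]
  · calc _ = (g (p.site k 0) ⬝ᵥ p.vec k 0 / f (p.site k 0) ⬝ᵥ p.vec k 0 -
            g (p.site k 1) ⬝ᵥ p.vec k 1 / f (p.site k 1) ⬝ᵥ p.vec k 1) • B +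
          (g' (p.site k 0) ⬝ᵥ p.vec k 0 / f (p.site k 0) ⬝ᵥ p.vec k 0 -
            g' (p.site k 1) ⬝ᵥ p.vec k 1 / f (p.site k 1) ⬝ᵥ p.vec k 1) • C := by
          simp only [hsum]; module
      _ = B := by rw [hg₀₁, hg'₀₁, one_smul, zero_smul, add_zero]
  · calc _ = (g (p.site k 2) ⬝ᵥ p.vec k 2 / f (p.site k 2) ⬝ᵥ p.vec k 2 -
            g (p.site k 3) ⬝ᵥ p.vec k 3 / f (p.site k 3) ⬝ᵥ p.vec k 3) • B +
          (g' (p.site k 2) ⬝ᵥ p.vec k 2 / f (p.site k 2) ⬝ᵥ p.vec k 2 -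
            g' (p.site k 3) ⬝ᵥ p.vec k 3 / f (p.site k 3) ⬝ᵥ p.vec k 3) • C := by
          simp only [hsum]; module
      _ = C := by rw [hg₂₃, hg'₂₃, one_smul, zero_smul, zero_add]

open Filter Topology in
theorem exists_cores_generic_pair (hr : 2 ≤ r) (hn : ∀ k, 4 ≤ n k) {p : Probes n}
    (hp : p.Admissible) (k : Fin d) :
    ∃ Q : Cores n r, (∀ i, (p.core Q k i).det ≠ 0) ∧
      (hankel (p.tracelessQuotient Q k 0 1)).det ≠ 0 ∧
      (hankel (p.tracelessQuotient Q k 2 3)).det ≠ 0 ∧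
      (wordMatrix (p.tracelessQuotient Q k 0 1) (p.tracelessQuotient Q k 2 3)).det ≠ 0 := by
  have : NeZero r := ⟨by omega⟩
  have hr₀ : (r : ℂ) ≠ 0 := NeZero.ne _
  let B : Matrix (Fin r) (Fin r) ℂ := diagonal fun i => (i.val : ℂ)
  obtain ⟨Q, X, hQ, hX₀₁, hX₂₃⟩ := exists_isScalarPerturbation_core hn hp k B (shiftMatrix r ℂ)
  have hinj : Function.Injective fun i : Fin r =>
      (r : ℂ) * (i.val : ℂ) - ∑ j : Fin r, (j.val : ℂ) := fun i j hij =>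
    Fin.ext (Nat.cast_injective (mul_left_cancel₀ hr₀ (sub_left_inj.1 hij)))
  have hB : traceFree (X 0 - X 1) =
      diagonal fun i : Fin r => (r : ℂ) * (i.val : ℂ) - ∑ j : Fin r, (j.val : ℂ) := by
    rw [hX₀₁, traceFree_diagonal]
  have hC : traceFree (X 2 - X 3) = (r : ℂ) • shiftMatrix r ℂ := by
    rw [hX₂₃, traceFree_shiftMatrix hr]
  have hword : (wordMatrix (traceFree (X 0 - X 1)) (traceFree (X 2 - X 3))).det ≠ 0 := by
    rw [hB, hC, ← one_smul ℂ (diagonal _)]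
    exact det_wordMatrix_smul_ne_zero one_ne_zero hr₀
      (det_wordMatrix_diagonal_shiftMatrix_ne_zero hinj)
  have hcore := eventually_all.2 fun i => (hQ i).eventually_det_ne_zero
  have hfst := (hQ 0).eventually_det_hankel_ne_zero (hQ 1)
    (hB ▸ det_hankel_diagonal_ne_zero hinj)
  have hsnd := (hQ 2).eventually_det_hankel_ne_zero (hQ 3)
    (hC ▸ det_hankel_smul_ne_zero hr₀ det_hankel_shiftMatrix_ne_zero)
  have hboth := (hQ 0).eventually_det_wordMatrix_ne_zero (hQ 1) (hQ 2) (hQ 3) hword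
  obtain ⟨ε, hε⟩ := (hcore.and (hfst.and (hsnd.and hboth))).exists
  exact ⟨Q ε, hε⟩

theorem analyticMat_core (p : Probes n) (k : Fin d) (i : Fin 4) :
    AnalyticMat fun Q : Cores n r => p.core Q k i :=
  analyticMat_probeCore _ _ _

theorem analyticMat_tracelessQuotient (p : Probes n) (k : Fin d) (i j : Fin 4) :
    AnalyticMat fun Q : Cores n r => p.tracelessQuotient Q k i j :=
  ((analyticMat_core p k i).mul (analyticMat_core p k j).adjugate).traceFree

theorem isAddHaarMeasure_volume_pi {ι : Type*} [Fintype ι] {E : ι → Type*}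
    [∀ i, NormedAddCommGroup (E i)] [∀ i, NormedSpace ℝ (E i)] [∀ i, MeasureSpace (E i)]
    [∀ i, BorelSpace (E i)] [∀ i, FiniteDimensional ℝ (E i)]
    [∀ i, (volume : Measure (E i)).IsAddHaarMeasure] :
    (volume : Measure (∀ i, E i)).IsAddHaarMeasure :=
  Measure.pi.isAddHaarMeasure _

instance isAddHaarMeasure_cores {d : ℕ} (n : Fin d → ℕ) (r : ℕ) :
    (volume : Measure (Cores n r)).IsAddHaarMeasure := by
  have hrow : (volume : Measure (Fin r → ℂ)).IsAddHaarMeasure := isAddHaarMeasure_volume_pi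
  have hslice : (volume : Measure (Fin r → Fin r → ℂ)).IsAddHaarMeasure :=
    isAddHaarMeasure_volume_pi
  have hcore : ∀ k, (volume : Measure (Fin (n k) → Fin r → Fin r → ℂ)).IsAddHaarMeasure :=
    fun _ => isAddHaarMeasure_volume_pi
  exact isAddHaarMeasure_volume_pi

theorem ae_generic (hr : 2 ≤ r) (hn : ∀ k, r ^ 2 ≤ n k) {p : Probes n} (hp : p.Admissible) :
    ∀ᵐ Q ∂(volume : Measure (Cores n r)), Generic p Q := by
  have hn4 : ∀ k, 4 ≤ n k := fun k => (Nat.pow_le_pow_left hr 2).trans (hn k)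
  choose P hP using fun k => exists_det_unfoldOne_ne_zero (hn k)
  choose R hcore hfst hsnd hword using exists_cores_generic_pair hr hn4 hp
  have hq := analyticMat_tracelessQuotient (r := r) p
  filter_upwards [
    ae_all_iff.2 fun k => ae_ne_zero_of_analyticOnNhd (volume : Measure (Cores n r))
      ((analyticMat_unfoldOne k).conjTranspose.mul (analyticMat_unfoldOne k)).det (hP k),
    ae_all_iff.2 fun k => ae_all_iff.2 fun i =>
      ae_ne_zero_of_analyticOnNhd volume (analyticMat_core p k i).det (hcore k i),
    ae_all_iff.2 fun k => ae_ne_zero_of_analyticOnNhd volume (hq k 0 1).hankel.det (hfst k),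
    ae_all_iff.2 fun k => ae_ne_zero_of_analyticOnNhd volume (hq k 2 3).hankel.det (hsnd k),
    ae_all_iff.2 fun k =>
      ae_ne_zero_of_analyticOnNhd volume ((hq k 0 1).wordMatrix (hq k 2 3)).det (hword k)]
    with Q hunfold hcore hfst hsnd hword
  exact ⟨hunfold, hcore, hfst, hsnd, hword⟩

end Generic

section Recovery

variable {d : ℕ} [NeZero d] {n : Fin d → ℕ} [∀ k, NeZero (n k)] {r : ℕ} {p : Probes n}
  {Q : Cores n r}

namespace Generic

theorem pinv_unfoldOne_mul (hQ : Generic p Q) (k : Fin d) :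
    pinv (unfoldOne Q k) * unfoldOne Q k = 1 :=
  pinv_mul_self_of_isUnit (hQ.unfold k).isUnit

theorem pinv_unfoldSq_mul (hQ : Generic p Q) (k : Fin d) :
    pinv (unfoldSq Q k) * unfoldSq Q k = 1 := by
  refine pinv_mul_self_of_isUnit (Ne.isUnit ?_)
  have hswap : (unfoldSq Q k)ᴴ * unfoldSq Q k = ((unfoldOne Q k)ᴴ * unfoldOne Q k).submatrix
      (Equiv.prodComm (Fin r) (Fin r)) (Equiv.prodComm (Fin r) (Fin r)) := rfl
  rw [hswap, det_submatrix_equiv_self]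
  exact hQ.unfold k

theorem exists_ringTensor_ne_zero [NeZero r] (hQ : Generic p Q) (hp : p.Admissible) :
    ∃ α, ringTensor Q α ≠ 0 := by
  by_contra! hzero
  refine hQ.core 0 0 ?_
  have hcore : p.core Q 0 0 = 0 := by
    refine Finset.sum_eq_zero fun c _ => ?_
    have htrace : (slice Q (0 - 1) 0 * slice Q 0 0 *
        probeProd Q 0 (p.site 0 0) (p.vec 0 0) c).trace = 0 := by
      simp only [probeProd, Matrix.mul_sum, trace_sum, Matrix.mul_smul, trace_smul,
        ← ringTensor_glue hp.two_le Q (hp.ne_left 0 0) (hp.ne_right 0 0), hzero, smul_zero,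
        Finset.sum_const_zero]
    rw [htrace, map_zero, zero_smul]
  rw [hcore, det_zero]

theorem normFactor_ne_zero [NeZero r] (hQ : Generic p Q) (hp : p.Admissible) :
    normFactor Q ≠ 0 :=
  let ⟨_, hα⟩ := hQ.exists_ringTensor_ne_zero hp
  BlostrMPS.normFactor_ne_zero hα

theorem isUnit_det_smul_core (hQ : Generic p Q) {c : ℂ} (hc : c ≠ 0) (k : Fin d) (i : Fin 4) :
    IsUnit (c • p.core Q k i).det := by
  rw [det_smul]
  exact (hc.isUnit.pow _).mul (hQ.core k i).isUnit

theorem probeMatrix_mul_pinv [NeZero r] (hQ : Generic p Q) (hp : p.Admissible) (k : Fin d)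
    (i j : Fin 4) :
    probeMatrix (threeBody (mpsState Q)) (k - 1) k (p.site k i) (p.vec k i) *
        pinv (probeMatrix (threeBody (mpsState Q)) (k - 1) k (p.site k j) (p.vec k j)) =
      unfoldOne Q k * amplify (Fin r) (p.quotient Q k i j) * pinv (unfoldOne Q k) := by
  have hc := hQ.normFactor_ne_zero hp
  have hmarginal : ∀ i, probeMatrix (threeBody (mpsState Q)) (k - 1) k (p.site k i) (p.vec k i) =
      unfoldOne Q k * amplify (Fin r) (normFactor Q • p.core Q k i) * (unfoldSq Q (k - 1))ᵀ :=
    fun i => probeMatrix_mpsState hp.two_le Q (hp.ne_left k i) (hp.ne_right k i) _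
  have hW : (unfoldSq Q (k - 1))ᵀ * pinv (unfoldSq Q (k - 1))ᵀ = 1 := by
    rw [pinv_transpose, ← transpose_mul, hQ.pinv_unfoldSq_mul, transpose_one]
  have hquotient : (normFactor Q • p.core Q k i) * (normFactor Q • p.core Q k j)⁻¹ =
      p.quotient Q k i j := by
    have hinv := inv_smul' (p.core Q k j) (Units.mk0 _ hc) (hQ.core k j).isUnit
    rw [Units.smul_mk0] at hinv
    rw [hinv, Units.smul_def, smul_mul_smul_comm, Units.val_inv_eq_inv_val, Units.val_mk0,
      mul_inv_cancel₀ hc, one_smul, Probes.quotient]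
  rw [hmarginal, hmarginal, pinv_mul_mul (hQ.pinv_unfoldOne_mul k)
    (isUnit_det_amplify (hQ.isUnit_det_smul_core hc k j)) hW, amplify_inv]
  calc _ = unfoldOne Q k * (amplify (Fin r) (normFactor Q • p.core Q k i) *
        ((unfoldSq Q (k - 1))ᵀ * pinv (unfoldSq Q (k - 1))ᵀ *
          amplify (Fin r) (normFactor Q • p.core Q k j)⁻¹)) * pinv (unfoldOne Q k) := by
        simp only [Matrix.mul_assoc]
    _ = _ := by rw [hW, Matrix.one_mul, ← amplify_mul, hquotient]

theorem isUnit_det_quotient (hQ : Generic p Q) (k : Fin d) (i j : Fin 4) :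
    IsUnit (p.quotient Q k i j).det := by
  rw [Probes.quotient, det_mul]
  exact (hQ.core k i).isUnit.mul (isUnit_nonsing_inv_det _ (hQ.core k j).isUnit)

theorem tracelessQuotient_eq (hQ : Generic p Q) (k : Fin d) (i j : Fin 4) :
    p.tracelessQuotient Q k i j = traceFree ((p.core Q k j).det • p.quotient Q k i j) := by
  rw [Probes.tracelessQuotient, mul_adjugate_eq_smul (hQ.core k j).isUnit, Probes.quotient]

theorem exists_diagonalizes_quotient [NeZero r] (hQ : Generic p Q) {k : Fin d} {i j : Fin 4}
    (h : (hankel (p.tracelessQuotient Q k i j)).det ≠ 0) :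
    ∃ V lam, Diagonalizes V (p.quotient Q k i j) lam := by
  obtain ⟨V, lam, hV⟩ := exists_diagonalizes_of_det_hankel_ne_zero h
  rw [hQ.tracelessQuotient_eq] at hV
  obtain ⟨lam', hV'⟩ := hV.of_traceFree
  have hquotient := hV'.smul (inv_ne_zero (hQ.core k j))
  rw [inv_smul_smul₀ (hQ.core k j)] at hquotient
  exact ⟨V, _, hquotient⟩

theorem inv_mul_apply_ne_zero [NeZero r] (hQ : Generic p Q) {k : Fin d}
    {V V' : Matrix (Fin r) (Fin r) ℂ} {lam lam' : Fin r → ℂ}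
    (hV : Diagonalizes V (p.quotient Q k 0 1) lam)
    (hV' : Diagonalizes V' (p.quotient Q k 2 3) lam') (b c : Fin r) : (V⁻¹ * V') b c ≠ 0 := by
  have hword := hQ.word k
  rw [hQ.tracelessQuotient_eq, hQ.tracelessQuotient_eq] at hword
  exact inv_mul_apply_ne_zero_of_det_wordMatrix hword (hV.smul (hQ.core k 1)).traceFree
    (hV'.smul (hQ.core k 3)).traceFree b c

end Generic

/-- `E` is the eigenframe of the product of the `i`-th probe matrix and the pseudoinverse of the
`j`-th one that is given by the eigenvectors `V` of the quotient and the bases `K b`. -/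
structure IsEigenFrame (p : Probes n) (Q : Cores n r) (k : Fin d) (i j : Fin 4)
    (E : Matrix (Fin (n k)) (Fin r × Fin r) ℂ) (V : Matrix (Fin r) (Fin r) ℂ)
    (K : Fin r → Matrix (Fin r) (Fin r) ℂ) : Prop where
  diagonalizes : ∃ lam, Diagonalizes V (p.quotient Q k i j) lam
  isUnit_block : ∀ b, IsUnit (K b).det
  eq_eigenFrame : E = eigenFrame (unfoldOne Q k) V K

theorem IsEigenFrame.isUnit_det {k : Fin d} {i j : Fin 4}
    {E : Matrix (Fin (n k)) (Fin r × Fin r) ℂ} {V : Matrix (Fin r) (Fin r) ℂ}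
    {K : Fin r → Matrix (Fin r) (Fin r) ℂ} (h : IsEigenFrame p Q k i j E V K) : IsUnit V.det :=
  let ⟨_, hV⟩ := h.diagonalizes
  hV.isUnit_det

theorem IsEigenFrame.rotate {k : Fin d} {i j : Fin 4}
    {E : Matrix (Fin (n k)) (Fin r × Fin r) ℂ} {V : Matrix (Fin r) (Fin r) ℂ}
    {K : Fin r → Matrix (Fin r) (Fin r) ℂ} (h : IsEigenFrame p Q k i j E V K)
    {G : Fin r → Fin r → Fin r → ℂ} (hG : ∀ b, (of (G b)).det ≠ 0) :
    IsEigenFrame p Q k i j (rotate G E) V fun b => K b * of (G b) where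
  diagonalizes := h.diagonalizes
  isUnit_block b := by
    rw [det_mul]
    exact (h.isUnit_block b).mul (hG b).isUnit
  eq_eigenFrame := by rw [h.eq_eigenFrame, rotate_eigenFrame]

omit [NeZero d] in
theorem ae_det_rotation_ne_zero (k : Fin d) (b : Fin r) :
    ∀ᵐ G : Fin d → Fin r → Fin r → Fin r → ℂ, (of (G k b)).det ≠ 0 := by
  have hG : AnalyticMat fun G : Fin d → Fin r → Fin r → Fin r → ℂ => of (G k b) :=
    analyticMat_slice (n := fun _ => r) k b
  refine ae_ne_zero_of_analyticOnNhd volume hG.det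
    (x₀ := fun _ _ => (1 : Matrix (Fin r) (Fin r) ℂ)) ?_
  exact (det_one (R := ℂ)).trans_ne one_ne_zero

variable [NeZero r]

omit [NeZero d] in
theorem ae_rotation_ne_zero (k : Fin d) {M B : Matrix (Fin r) (Fin r) ℂ} (hM : IsUnit M.det)
    (hB : IsUnit B.det) :
    ∀ᵐ G : Fin d → Fin r → Fin r → Fin r → ℂ, ((M * of (G k 0))ᵀ * B) 0 0 ≠ 0 := by
  obtain ⟨i, hi⟩ : ∃ i, B i 0 ≠ 0 := by
    by_contra! hcol
    exact hB.ne_zero (det_eq_zero_of_column_eq_zero 0 hcol)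
  have hG : AnalyticMat fun G : Fin d → Fin r → Fin r → Fin r → ℂ => of (G k 0) :=
    analyticMat_slice (n := fun _ => r) k 0
  have hMG : AnalyticMat fun G : Fin d → Fin r → Fin r → Fin r → ℂ => (M * of (G k 0))ᵀ * B :=
    AnalyticMat.mul (fun a b => ((AnalyticMat.const M).mul hG) b a) (AnalyticMat.const B)
  refine ae_ne_zero_of_analyticOnNhd volume (hMG 0 0) (x₀ := fun _ _ => M⁻¹ * single i 0 1) ?_
  have hsingle : M * of (M⁻¹ * single i 0 1) = single i 0 (1 : ℂ) :=
    mul_nonsing_inv_cancel_left _ _ hM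
  dsimp only
  rw [hsingle, transpose_single]
  simpa using hi

namespace Generic

theorem isEigenbasis_iff (hQ : Generic p Q) (hp : p.Admissible) {k : Fin d} {i j : Fin 4}
    {E : Matrix (Fin (n k)) (Fin r × Fin r) ℂ} :
    IsEigenbasis (probeMatrix (threeBody (mpsState Q)) (k - 1) k (p.site k i) (p.vec k i) *
        pinv (probeMatrix (threeBody (mpsState Q)) (k - 1) k (p.site k j) (p.vec k j))) E ↔
      ∃ V K, IsEigenFrame p Q k i j E V K := by
  rw [hQ.probeMatrix_mul_pinv hp]
  constructor
  · intro hE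
    obtain ⟨V, lam, K, hV, hK, rfl⟩ := hE.exists_eq_eigenFrame (hQ.pinv_unfoldOne_mul k)
    exact ⟨V, K, ⟨lam, hV⟩, hK, rfl⟩
  · rintro ⟨V, K, ⟨lam, hV⟩, hK, rfl⟩
    exact isEigenbasis_eigenFrame (hQ.pinv_unfoldOne_mul k) hV
      (hV.eigenvalue_ne_zero (hQ.isUnit_det_quotient k i j)) hK

theorem exists_isEigenbasis (hQ : Generic p Q) (hp : p.Admissible) {k : Fin d} {i j : Fin 4}
    (h : (hankel (p.tracelessQuotient Q k i j)).det ≠ 0) :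
    ∃ E : Matrix (Fin (n k)) (Fin r × Fin r) ℂ,
      IsEigenbasis (probeMatrix (threeBody (mpsState Q)) (k - 1) k (p.site k i) (p.vec k i) *
        pinv (probeMatrix (threeBody (mpsState Q)) (k - 1) k (p.site k j) (p.vec k j))) E := by
  obtain ⟨V, hV⟩ := hQ.exists_diagonalizes_quotient h
  exact ⟨_, (hQ.isEigenbasis_iff hp).2 ⟨V, fun _ => 1, hV, fun _ => by simp, rfl⟩⟩

theorem exists_isEigenChoice (hQ : Generic p Q) (hp : p.Admissible) :
    ∃ E E' : Bases n r, IsEigenChoice (threeBody (mpsState Q)) p E E' := by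
  choose E hE using fun k => hQ.exists_isEigenbasis hp (hQ.hankel_fst k)
  choose E' hE' using fun k => hQ.exists_isEigenbasis hp (hQ.hankel_snd k)
  exact ⟨E, E', fun k => ⟨hE k, hE' k⟩⟩

theorem isEigenChoice_iff (hQ : Generic p Q) (hp : p.Admissible) {E E' : Bases n r} :
    IsEigenChoice (threeBody (mpsState Q)) p E E' ↔
      ∃ (V V' : Fin d → Matrix (Fin r) (Fin r) ℂ)
        (K K' : Fin d → Fin r → Matrix (Fin r) (Fin r) ℂ),
        (∀ k, IsEigenFrame p Q k 0 1 (E k) (V k) (K k)) ∧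
          ∀ k, IsEigenFrame p Q k 2 3 (E' k) (V' k) (K' k) := by
  simp only [IsEigenChoice, hQ.isEigenbasis_iff hp, forall_and, Classical.skolem]
  exact ⟨fun ⟨⟨V, K, h⟩, V', K', h'⟩ => ⟨V, V', K, K', h, h'⟩,
    fun ⟨V, V', K, K', h, h'⟩ => ⟨⟨V, K, h⟩, V', K', h'⟩⟩

variable {E E' : Bases n r} {V V' : Fin d → Matrix (Fin r) (Fin r) ℂ}
  {K K' : Fin d → Fin r → Matrix (Fin r) (Fin r) ℂ}

theorem inv_mul_apply_ne_zero_of_isEigenFrame (hQ : Generic p Q) {k : Fin d}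
    (h : IsEigenFrame p Q k 0 1 (E k) (V k) (K k))
    (h' : IsEigenFrame p Q k 2 3 (E' k) (V' k) (K' k)) (b : Fin r) :
    ((V k)⁻¹ * V' k) b 0 ≠ 0 := by
  obtain ⟨lam, hV⟩ := h.diagonalizes
  obtain ⟨lam', hV'⟩ := h'.diagonalizes
  exact hQ.inv_mul_apply_ne_zero hV hV' b 0

theorem hatDefined (hQ : Generic p Q) (h : ∀ k, IsEigenFrame p Q k 0 1 (E k) (V k) (K k))
    (h' : ∀ k, IsEigenFrame p Q k 2 3 (E' k) (V' k) (K' k)) : HatDefined E E' := by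
  intro k
  have hU := hQ.pinv_unfoldOne_mul k
  have hV := (h k).isUnit_det
  have hne := hQ.inv_mul_apply_ne_zero_of_isEigenFrame (h k) (h' k)
  have hK := (h k).isUnit_block
  have hK' := (h' k).isUnit_block
  rw [(h k).eq_eigenFrame, (h' k).eq_eigenFrame]
  exact ⟨fun l => isUnit_det_blockF_eigenFrame hU hV hK hK' (hne l),
    isUnit_det_blockDiagonal (isUnit_det_hatK_eigenFrame hU hV hK hK' hne)⟩

theorem pairRecovery (hQ : Generic p Q) (hp : p.Admissible)
    (h : ∀ k, IsEigenFrame p Q k 0 1 (E k) (V k) (K k))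
    (h' : ∀ k, IsEigenFrame p Q k 2 3 (E' k) (V' k) (K' k)) :
    PairRecovery Q (threeBody (mpsState Q)) p E E' (fun k => (K k 0)ᵀ)
      (fun k => rightFactor (V k) (V' k)) fun k => normFactor Q • p.core Q k 0 where
  isUnit_left k := by
    rw [det_transpose]
    exact (h k).isUnit_block 0
  isUnit_right k := isUnit_det_rightFactor (h k).isUnit_det
    (hQ.inv_mul_apply_ne_zero_of_isEigenFrame (h k) (h' k))
  isUnit_mid k := hQ.isUnit_det_smul_core (hQ.normFactor_ne_zero hp) k 0
  pinv_unfoldOne := hQ.pinv_unfoldOne_mul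
  pinv_unfoldSq := hQ.pinv_unfoldSq_mul
  hatUnfold_eq k := by
    rw [(h k).eq_eigenFrame, (h' k).eq_eigenFrame, transpose_transpose]
    exact hatUnfold_eigenFrame (hQ.pinv_unfoldOne_mul k) (h k).isUnit_det (h k).isUnit_block
      (h' k).isUnit_block (hQ.inv_mul_apply_ne_zero_of_isEigenFrame (h k) (h' k))
  probeMatrix_eq j := by
    have hprobe := probeMatrix_mpsState hp.two_le Q (hp.ne_left (j + 1) 0)
      (hp.ne_right (j + 1) 0) (p.vec (j + 1) 0)
    rwa [add_sub_cancel_right] at hprobe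

theorem ae_rotate (hQ : Generic p Q) (hp : p.Admissible)
    (h : ∀ k, IsEigenFrame p Q k 0 1 (E k) (V k) (K k))
    (h' : ∀ k, IsEigenFrame p Q k 2 3 (E' k) (V' k) (K' k)) :
    ∀ᵐ G : Fin d → Fin r → Fin r → Fin r → ℂ,
      IsEigenChoice (threeBody (mpsState Q)) p (fun k => rotate (G k) (E k)) E' ∧
        GaugeDefined (threeBody (mpsState Q)) p (fun k => rotate (G k) (E k)) E' := by
  have hrun := hQ.pairRecovery hp h h'
  filter_upwards [
    ae_all_iff.2 fun k : Fin d => ae_all_iff.2 fun b : Fin r => ae_det_rotation_ne_zero k b,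
    ae_all_iff.2 fun k : Fin d =>
      ae_rotation_ne_zero (k + 1) ((h (k + 1)).isUnit_block 0) (hrun.isUnit_right k)]
    with G hdet hentry
  have hG : ∀ k, IsEigenFrame p Q k 0 1 (rotate (G k) (E k)) (V k) _ := fun k =>
    (h k).rotate (hdet k)
  exact ⟨(hQ.isEigenChoice_iff hp).2 ⟨V, V', _, K', hG, h'⟩,
    fun k => (hQ.pairRecovery hp hG h').isUnit_det_matN (hentry k)⟩

end Generic

end Recovery

end BlostrMPS

theorem theorem3 (d r : ℕ) [NeZero d] [NeZero r] (hd : 3 ≤ d) (hr : 2 ≤ r)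
    (n : Fin d → ℕ) [∀ k, NeZero (n k)] (hn : ∀ k, r ^ 2 ≤ n k)
    (p : BlostrMPS.Probes n) (hp : p.Admissible)
    (μ : Measure (BlostrMPS.Cores n r)) [IsProbabilityMeasure μ]
    (hμ : μ ≪ (volume : Measure (BlostrMPS.Cores n r))) :
    ∀ᵐ Q ∂μ,
      -- the state is a unit vector
      (∑ α, ‖BlostrMPS.mpsState Q α‖ ^ 2 = 1) ∧
      -- the eigenbases requested by the algorithm exist
      (∃ E E' : BlostrMPS.Bases n r,
        BlostrMPS.IsEigenChoice (BlostrMPS.threeBody (BlostrMPS.mpsState Q)) p E E') ∧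
      ∀ E E' : BlostrMPS.Bases n r,
        BlostrMPS.IsEigenChoice (BlostrMPS.threeBody (BlostrMPS.mpsState Q)) p E E' →
        BlostrMPS.HatDefined E E' ∧
        -- for generic bases of the eigenspaces the algorithm runs to the end
        (∀ᵐ G : Fin d → Fin r → Fin r → Fin r → ℂ,
          BlostrMPS.IsEigenChoice (BlostrMPS.threeBody (BlostrMPS.mpsState Q)) p
            (fun k => BlostrMPS.rotate (G k) (E k)) E' ∧
          BlostrMPS.GaugeDefined (BlostrMPS.threeBody (BlostrMPS.mpsState Q)) p
            (fun k => BlostrMPS.rotate (G k) (E k)) E') ∧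
        -- whenever it runs to the end, it recovers the cores and the state
        (BlostrMPS.GaugeDefined (BlostrMPS.threeBody (BlostrMPS.mpsState Q)) p E E' →
          (∃ c : ℂ, c ≠ 0 ∧ BlostrMPS.GaugeEquiv Q
            (BlostrMPS.scaleFirst c
              (BlostrMPS.output (BlostrMPS.threeBody (BlostrMPS.mpsState Q)) p E E'))) ∧
          ∃ z : ℂ, ‖z‖ = 1 ∧ ∀ α,
            BlostrMPS.mpsState
              (BlostrMPS.output (BlostrMPS.threeBody (BlostrMPS.mpsState Q)) p E E') α =
              z * BlostrMPS.mpsState Q α) := by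
  filter_upwards [hμ.ae_le (BlostrMPS.ae_generic hr hn hp)] with Q hQ
  obtain ⟨α, hα⟩ := hQ.exists_ringTensor_ne_zero hp
  refine ⟨BlostrMPS.sum_norm_sq_mpsState hα, hQ.exists_isEigenChoice hp, fun E E' hE => ?_⟩
  obtain ⟨V, V', K, K', h, h'⟩ := (hQ.isEigenChoice_iff hp).1 hE
  refine ⟨hQ.hatDefined h h', hQ.ae_rotate hp h h', fun hN => ?_⟩
  obtain ⟨σ, L, hout⟩ := (hQ.pairRecovery hp h h').exists_slice_output hN
  obtain ⟨c, hc, hgauge⟩ := BlostrMPS.exists_scaleFirst_gaugeEquiv hout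
  exact ⟨⟨c, hc, hgauge⟩, BlostrMPS.exists_phase_mpsState_of_gaugeEquiv hc hgauge⟩
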